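/- Fix an integer $m\ge 2$ and a set $C$ of $m$ candidates. A vote is a linear order on $C$; a voting rule $r$ maps the histogram of $n$ votes to a single winner. Let $X=(X_1,\dots,X_n)$ consist of $n\ge 1$ independent votes, each uniform over the $m!$ linear orders on $C$, and let $\mathbf M_r(X)$ be the winner of $r$ under $X$ (only the winner is announced). A mechanism $\mathbf M$ is $(\epsilon,\delta)$-DDP for $X$ (no auxiliary information) if for every row $i$, all $x,x'$ in the support of $X_i$ and every set $S$ of outputs $$\Pr(\mathbf M(X)\in S\mid X_i=x)\le e^{\epsilon}\Pr(\mathbf M(X)\in S\mid X_i=x')+\delta .$$ It is $(\epsilon,\delta)$-DDP in the simulation-based sense if there is a randomized map $\mathbf{Sim}$ such that for all $i$, all $x$ in the support of $X_i$ and all $S$, $\Pr(\mathbf M(X)\in S\mid X_i=x)\le e^{\epsilon}\Pr(\mathbf{Sim}(X_{-i})\in S\mid X_i=x)+\delta$ and $\Pr(\mathbf{Sim}(X_{-i})\in S\mid X_i=x)\le e^{\epsilon}\Pr(\mathbf M(X)\in S\mid X_i=x)+\delta$, where $X_{-i}$ is $X$ without row $i$. For either notion, $\mathbf M$ is $(\epsilon,\delta)$-exact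 DDP (with $\epsilon,\delta\ge 0$) if it is $(\epsilon,\delta)$-DDP but not $(\epsilon',\delta')$-DDP for any $\epsilon',\delta'\ge0$ with ($\epsilon'\le\epsilon$ and $\delta'<\delta$) or ($\epsilon'<\epsilon$ and $\delta'\le\delta$). Write $N(a,b)$ for the number of votes ranking $a$ above $b$. Consider the following rules; whenever several candidates are tied, the winner is the tied candidate that comes first in an arbitrary fixed priority order on $C$. 1. Plurality, veto, $k$-approval for $1\le k\le m-1$, and Borda: the positional scoring rules with scoring vectors $(1,0,\dots,0)$, $(1,\dots,1,0)$, $(1,\dots,1,0,\dots,0)$ with $k$ ones, and $(m-1,m-2,\dots,0)$. 2. Maximin: maximize $\min_{b\ne a}N(a,b)$. 3. Copeland, for any $\alpha\in[0,1]$: maximize the number of pairwise victories plus $\alpha$ times the number of pairwise ties. 4. Bucklin: for the least $k$ for which some candidate is among the top $k$ in more than half of the votes, choose the candidate that is among the top $k$ in the most votes. 5. Ranked Pairs: go through the ordered pairs $(a,b)$, $a\neq b$, by decreasing $N(a,b)$ (equal values ordered by an arbitrary fixed linear order on the ordered pairs) and lock each pair unless it closes a cycle with the locked ones; the winner is the candidate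 against whom no pair is locked. 6. Schulze: let $p(a,b)$ be the maximum over paths from $a$ to $b$ of the least $N(x,y)$ over the links $x\to y$ of the path; $a$ wins if $p(a,b)\ge p(b,a)$ for all $b\neq a$. For each of these rules $r$, and for each of the two forms of DDP, there is a function $\delta(n)=\Theta(1/\sqrt n)$ as $n\to\infty$ (with $m$, the rule and the tie-breaking fixed) such that for every $n\ge1$ the mechanism $\mathbf M_r$ is $(0,\delta(n))$-exact DDP. -/

import Mathlib

open Filter Asymptotics

noncomputable section

namespace Voting

/-! ### Distributional differential privacy without auxiliary information -/

section Privacy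

variable {U R : Type*} {n : ℕ}

/-- The value `x` lies in the support of row `i` of the random database `X`. -/
def RowSupp (X : PMF (Fin n → U)) (i : Fin n) (x : U) : Prop :=
  ∃ D ∈ {D : Fin n → U | D i = x}, D ∈ X.support

/-- `Pr(M(X) ∈ S | X_i = x)` for a randomized map `M` on databases with `n` rows. -/
def condProb (X : PMF (Fin n → U)) (M : (Fin n → U) → PMF R) (i : Fin n) (x : U)
    (hx : RowSupp X i x) (S : Set R) : ℝ :=
  (((X.filter {D | D i = x} hx).bind M).toOuterMeasure S).toReal

/-- The row-swapping form of `(ε, δ)`-DDP for `Δ = {(X, ∅)}`: the laws of `M(X)` given `X_i = x`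
and given `X_i = x'` are `(ε, δ)`-close. -/
def IsDDP (X : PMF (Fin n → U)) (M : (Fin n → U) → PMF R) (ε δ : ℝ) : Prop :=
  ∀ (i : Fin n) (x x' : U) (hx : RowSupp X i x) (hx' : RowSupp X i x') (S : Set R),
    condProb X M i x hx S ≤ Real.exp ε * condProb X M i x' hx' S + δ

/-- The simulation-based form of `(ε, δ)`-DDP for `Δ = {(X, ∅)}`: a single randomized simulator,
which sees the database with row `i` removed, imitates `M(X)` given `X_i = x`. -/
def IsSimDDP (X : PMF (Fin (n + 1) → U)) (M : (Fin (n + 1) → U) → PMF R) (ε δ : ℝ) : Prop :=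
  ∃ Sim : (Fin n → U) → PMF R,
    ∀ (i : Fin (n + 1)) (x : U) (hx : RowSupp X i x) (S : Set R),
      condProb X M i x hx S ≤
          Real.exp ε * condProb X (fun D => Sim (i.removeNth D)) i x hx S + δ ∧
      condProb X (fun D => Sim (i.removeNth D)) i x hx S ≤
          Real.exp ε * condProb X M i x hx S + δ

/-- Exactness of the nonnegative parameters `(ε, δ)` for a privacy notion: the notion holds with
them, and it does not hold with any strictly better pair of nonnegative parameters. -/
def IsExact (Priv : ℝ → ℝ → Prop) (ε δ : ℝ) : Prop :=
  0 ≤ ε ∧ 0 ≤ δ ∧ Priv ε δ ∧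
  (∀ ε' δ' : ℝ, 0 ≤ ε' → 0 ≤ δ' → ε' ≤ ε → δ' < δ → ¬ Priv ε' δ') ∧
  (∀ ε' δ' : ℝ, 0 ≤ ε' → 0 ≤ δ' → ε' < ε → δ' ≤ δ → ¬ Priv ε' δ')

/-- The law of a database with `n` independent rows, each distributed according to `p`. -/
def iid [Fintype U] (n : ℕ) (p : PMF U) : PMF (Fin n → U) :=
  PMF.ofFintype (fun D => ∏ i, p (D i)) (by
    classical
    have h := Finset.sum_prod_piFinset (ι := Fin n) (Finset.univ : Finset U) (fun _ u => p u)
    rw [Fintype.piFinset_univ] at h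
    rw [h]
    have h1 : ∑ u, p u = 1 := (tsum_fintype (fun u => p u)).symm.trans p.tsum_coe
    simp [h1])

end Privacy

/-! ### Profiles and voting rules -/

/-- A linear order on the `m` candidates `Fin m`, given by positions: `V c` is the position of `c`,
with `0` the top, so that `a` is ranked above `b` iff `V a < V b`. -/
abbrev Ranking (m : ℕ) := Equiv.Perm (Fin m)

/-- A profile is the histogram of the votes. -/
abbrev Profile (m : ℕ) := Ranking m → ℕ

variable {m : ℕ}

/-- The histogram of a database of votes. -/
def hist {n : ℕ} (D : Fin n → Ranking m) : Profile m :=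
  fun V => (Finset.univ.filter (fun i => D i = V)).card

/-- The number of votes in a profile. -/
def numVotes (P : Profile m) : ℕ := ∑ V, P V

/-- The number of votes that rank `a` above `b`. -/
def prefCount (P : Profile m) (a b : Fin m) : ℕ := ∑ V : Ranking m, if V a < V b then P V else 0

/-- The number of votes that rank `a` among the top `k` candidates. -/
def topCount (P : Profile m) (k : ℕ) (a : Fin m) : ℕ :=
  ∑ V : Ranking m, if (V a : ℕ) < k then P V else 0

/-- A voting rule before tie-breaking: every profile has a nonempty set of (tied) winners. -/
structure Rule (m : ℕ) where
  winners : Profile m → Finset (Fin m)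
  nonempty : ∀ P, (winners P).Nonempty

/-- The single winner: the tied winner placed highest by the priority order `tie`. -/
def Rule.winner (r : Rule m) (tie : Ranking m) (P : Profile m) : Fin m :=
  tie.symm (((r.winners P).image tie).min' ((r.nonempty P).image tie))

open Classical in
/-- The rule whose winners are the candidates of maximum score. -/
def scoreRule [NeZero m] {α : Type*} [LinearOrder α] (score : Profile m → Fin m → α) : Rule m where
  winners P := Finset.univ.filter (fun a => ∀ b, score P b ≤ score P a)
  nonempty P := by
    obtain ⟨a, ha⟩ := Finite.exists_max (score P)
    exact ⟨a, by simpa using ha⟩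

/-- The positional scoring rule with scoring vector `s`. -/
def positional [NeZero m] (s : Fin m → ℝ) : Rule m :=
  scoreRule (fun P a => ∑ V : Ranking m, (P V : ℝ) * s (V a))

def plurality [NeZero m] : Rule m := positional (fun j => if (j : ℕ) = 0 then 1 else 0)

def veto [NeZero m] : Rule m := positional (fun j => if (j : ℕ) + 1 = m then 0 else 1)

def kApproval [NeZero m] (k : ℕ) : Rule m := positional (fun j => if (j : ℕ) < k then 1 else 0)

def borda [NeZero m] : Rule m := positional (fun j => (m : ℝ) - 1 - (j : ℝ))

/-- Maximin: the score of `a` is the minimum of `prefCount P a b` over the opponents `b`. -/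
def maximin [NeZero m] : Rule m :=
  scoreRule (fun P a => (Finset.univ.erase a).inf (fun b => (prefCount P a b : ℕ∞)))

/-- Copeland: a pairwise win is worth `1`, a pairwise tie `α`, a pairwise defeat `0`. -/
def copeland [NeZero m] (α : ℝ) : Rule m :=
  scoreRule (fun P a => ∑ b ∈ Finset.univ.erase a,
    if prefCount P b a < prefCount P a b then (1 : ℝ)
    else if prefCount P a b = prefCount P b a then α else 0)

/-- The first `k` such that some candidate is among the top `k` in more than half of the votes. -/
def bucklinRound (P : Profile m) : ℕ := sInf {k | ∃ a, numVotes P < 2 * topCount P k a}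

/-- Bucklin: in the first round with a majority, the candidates with the most top-`k` votes. -/
def bucklin [NeZero m] : Rule m := scoreRule (fun P a => topCount P (bucklinRound P) a)

/-! #### Ranked Pairs -/

/-- One step of Ranked Pairs: lock the pair `e` unless it closes a cycle with the locked pairs. -/
def lockStep (L : Finset (Fin m × Fin m)) (e : Fin m × Fin m) : Finset (Fin m × Fin m) :=
  open Classical in
  if Relation.ReflTransGen (fun x y => (x, y) ∈ L) e.2 e.1 then L else insert e L

/-- The ordered pairs of distinct candidates by decreasing `prefCount`, ties in the order `τ`. -/
def sortedPairs (τ : Fin m × Fin m ≃ Fin (m * m)) (P : Profile m) : List (Fin m × Fin m) :=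
  (Finset.univ.filter (fun e : Fin m × Fin m => e.1 ≠ e.2)).toList.mergeSort
    (fun e f => decide (prefCount P f.1 f.2 < prefCount P e.1 e.2 ∨
      (prefCount P f.1 f.2 = prefCount P e.1 e.2 ∧ τ e ≤ τ f)))

/-- The pairs locked by Ranked Pairs. -/
def lockedPairs (τ : Fin m × Fin m ≃ Fin (m * m)) (P : Profile m) : Finset (Fin m × Fin m) :=
  (sortedPairs τ P).foldl lockStep ∅

theorem lockStep_acyclic (L : Finset (Fin m × Fin m)) (e : Fin m × Fin m)
    (hL : ∀ a, ¬ Relation.TransGen (fun x y => (x, y) ∈ L) a a) :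
    ∀ a, ¬ Relation.TransGen (fun x y => (x, y) ∈ lockStep L e) a a := by
  classical
  unfold lockStep
  split_ifs with h
  · exact hL
  · have key : ∀ a b, Relation.TransGen (fun x y => (x, y) ∈ insert e L) a b →
        Relation.TransGen (fun x y => (x, y) ∈ L) a b ∨
        (Relation.ReflTransGen (fun x y => (x, y) ∈ L) a e.1 ∧
          Relation.ReflTransGen (fun x y => (x, y) ∈ L) e.2 b) := by
      intro a b hab
      induction hab with
      | single hb =>
        rcases Finset.mem_insert.1 hb with hb | hb
        · right; rw [← hb]; exact ⟨.refl, .refl⟩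
        · left; exact .single hb
      | tail _ hbc ih =>
        rcases Finset.mem_insert.1 hbc with hb | hb
        · right
          rw [← hb]
          rcases ih with ih | ih
          · exact ⟨ih.to_reflTransGen, .refl⟩
          · exact absurd (by rw [← hb] at ih ⊢; exact ih.2) h
        · rcases ih with ih | ih
          · left; exact ih.tail hb
          · right; exact ⟨ih.1, ih.2.tail hb⟩
    intro a ha
    rcases key a a ha with h1 | h1
    · exact hL a h1
    · exact h (h1.2.trans h1.1)

theorem foldl_lockStep_acyclic (l : List (Fin m × Fin m)) (L : Finset (Fin m × Fin m))
    (hL : ∀ a, ¬ Relation.TransGen (fun x y => (x, y) ∈ L) a a) :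
    ∀ a, ¬ Relation.TransGen (fun x y => (x, y) ∈ l.foldl lockStep L) a a := by
  induction l generalizing L with
  | nil => exact hL
  | cons e l ih => exact ih _ (lockStep_acyclic L e hL)

/-- A transitive irreflexive relation on the candidates has a candidate that nobody beats. -/
theorem exists_unbeaten [NeZero m] (r : Fin m → Fin m → Prop) (hirr : ∀ a, ¬ r a a)
    (htr : ∀ a b c, r a b → r b c → r a c) : ∃ a, ∀ b, ¬ r b a := by
  have : IsTrans (Fin m) r := ⟨htr⟩
  have : Std.Irrefl r := ⟨hirr⟩
  obtain ⟨a, -, ha⟩ := (Finite.wellFounded_of_trans_of_irrefl r).has_min Set.univ ⟨0, trivial⟩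
  exact ⟨a, fun b => ha b trivial⟩

open Classical in
/-- Ranked Pairs: the winner is the candidate with no locked pair against it. -/
def rankedPairs [NeZero m] (τ : Fin m × Fin m ≃ Fin (m * m)) : Rule m where
  winners P := Finset.univ.filter (fun a => ∀ b, (b, a) ∉ lockedPairs τ P)
  nonempty P := by
    have hac := foldl_lockStep_acyclic (sortedPairs τ P) ∅ (fun a h => by
      obtain ⟨_, h1, _⟩ := Relation.TransGen.head'_iff.1 h
      simp at h1)
    obtain ⟨a, ha⟩ := exists_unbeaten _ hac (fun _ _ _ h1 h2 => h1.trans h2)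
    exact ⟨a, Finset.mem_filter.2 ⟨Finset.mem_univ a, fun b hb => ha b (.single hb)⟩⟩

/-! #### Schulze -/

/-- There is a path from `a` to `b` every link `x → y` of which has at least `t` votes that rank
`x` above `y`. -/
def HasPath (P : Profile m) (t : ℕ) (a b : Fin m) : Prop :=
  Relation.TransGen (fun x y => x ≠ y ∧ t ≤ prefCount P x y) a b

/-- The strength of the strongest path from `a` to `b` (used for `a ≠ b` only). -/
def pathStrength (P : Profile m) (a b : Fin m) : ℕ := sSup {t | HasPath P t a b}

theorem HasPath.le {P : Profile m} {t : ℕ} {a b : Fin m} (h : HasPath P t a b) :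
    t ≤ numVotes P := by
  obtain ⟨c, h1, _⟩ := Relation.TransGen.head'_iff.1 h
  refine h1.2.trans (Finset.sum_le_sum fun V _ => ?_)
  split_ifs <;> simp

theorem le_pathStrength_iff {P : Profile m} {t : ℕ} {a b : Fin m} (hab : a ≠ b) :
    t ≤ pathStrength P a b ↔ HasPath P t a b := by
  have hb : BddAbove {t | HasPath P t a b} := ⟨numVotes P, fun _ h => h.le⟩
  refine ⟨fun h => ?_, fun h => le_csSup hb h⟩
  have hm : HasPath P (pathStrength P a b) a b :=
    Nat.sSup_mem ⟨0, .single ⟨hab, Nat.zero_le _⟩⟩ hb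
  exact Relation.TransGen.mono (r := fun x y => x ≠ y ∧ pathStrength P a b ≤ prefCount P x y)
    (fun x y hxy => And.intro hxy.1 (h.trans hxy.2)) a b hm

open Classical in
/-- Schulze: the candidates whose strongest path to each other candidate is at least as strong as
the strongest path back. -/
def schulze [NeZero m] : Rule m where
  winners P := Finset.univ.filter (fun a => ∀ b, b ≠ a → pathStrength P b a ≤ pathStrength P a b)
  nonempty P := by
    obtain ⟨a, ha⟩ := exists_unbeaten
      (fun x y => x ≠ y ∧ pathStrength P y x < pathStrength P x y) (fun a h => h.1 rfl) (by
        rintro a b c ⟨hab, h1⟩ ⟨hbc, h2⟩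
        have hac : a ≠ c := by
          rintro rfl
          exact absurd h1 (by omega)
        refine ⟨hac, ?_⟩
        by_contra hcon
        push Not at hcon
        have tr : ∀ {t x y z}, x ≠ y → y ≠ z → x ≠ z → t ≤ pathStrength P x y →
            t ≤ pathStrength P y z → t ≤ pathStrength P x z := fun hxy hyz hxz p q =>
          (le_pathStrength_iff hxz).2
            (((le_pathStrength_iff hxy).1 p).trans ((le_pathStrength_iff hyz).1 q))
        rcases le_total (pathStrength P a b) (pathStrength P b c) with h | h
        · have h3 := tr hab hbc hac le_rfl h
          have h4 := tr hbc hac.symm hab.symm h (h3.trans hcon)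
          omega
        · have h3 := tr hab hbc hac h le_rfl
          have h4 := tr hac.symm hab hbc.symm (h3.trans hcon) h
          omega)
    exact ⟨a, by simpa using fun b hb => not_lt.1 fun h => ha b ⟨hb, h⟩⟩

/-! ### The mechanism that announces the winner -/

/-- The (deterministic) mechanism that maps `n` votes to the winner. -/
def winnerMechanism (r : Rule m) (tie : Ranking m) (n : ℕ) (D : Fin n → Ranking m) :
    PMF (Fin m) :=
  PMF.pure (r.winner tie (hist D))

/-- The law of `n` independent votes, uniform over all linear orders. -/
def uniformVotes (m n : ℕ) : PMF (Fin n → Ranking m) := iid n (PMF.uniformOfFintype (Ranking m))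

/-- Announcing the winner of `r` is `(0, δ(n))`-exact DDP with `δ(n) = Θ(1/√n)` for i.i.d. uniform
votes, both in the row-swapping and in the simulation-based form of DDP; the number of votes is
`n + 1` since databases have at least one row. -/
def IsInvSqrtExactDDP (r : Rule m) (tie : Ranking m) : Prop :=
  (∃ δ : ℕ → ℝ, δ =Θ[atTop] (fun n : ℕ => 1 / Real.sqrt n) ∧
    ∀ n : ℕ, IsExact (IsDDP (uniformVotes m (n + 1)) (winnerMechanism r tie (n + 1)))
      0 (δ (n + 1))) ∧
  (∃ δ : ℕ → ℝ, δ =Θ[atTop] (fun n : ℕ => 1 / Real.sqrt n) ∧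
    ∀ n : ℕ, IsExact (IsSimDDP (uniformVotes m (n + 1)) (winnerMechanism r tie (n + 1)))
      0 (δ (n + 1)))

end Voting

end

/-!
The mechanism only sees the histogram of the votes, so fixing one of `n` uniform votes at `x`
amounts to weighting all databases by the number `h x` of votes for `x`. With `N = m!`, the
influence of one vote on the law of the winner is therefore `N / n` times the correlation of the
event `winner ∈ S` with `h x - h x'`, which is the identity `winProb_sub_winProb`.

The upper bound holds for every rule: the second moment of `h x - h x'` is at most `2 n`, and the
Cauchy-Schwarz inequality bounds the correlation by `√(2 n)` (`sum_hist_sub_mul_le`).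

For the lower bound, let `a` be the candidate of highest priority, which wins as soon as it is among
the tied winners, and let `x` arise from `x'` by moving `a` from the bottom to the top. Exchanging
the votes for `x` and `x'` preserves the uniform law, and all the rules are monotone, so after
pairing each database with its exchanged partner every contribution to the correlation with
`winner = a` is nonnegative. It is of order `√n` whenever `h x` exceeds and `h x'` falls short of the mean
by a large multiple of `√n` that outweighs the deviations of all other rankings: then `a` beats
every candidate in every pairwise and every top-`k` count, and loses all of these comparisons once
`x` and `x'` are exchanged. Such databases have probability bounded below
(`exists_tilted_fraction`): under product weights shifted by multiples of `1/√n` they are typical by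
Chebyshev's inequality, and the density of the shifted weights is bounded on them. The property
`Responsive` collects what is needed of a rule: monotonicity and the outcome in these two extreme
situations.

With `ε = 0` the exact `δ` of the row-swapping form is the largest influence. For the simulation
form, the row withheld from the simulator is independent of the rows it sees, so a simulator is as
good as the law of its output; the best law exists by compactness, and its error lies between half
of the largest influence and the uniform upper bound.
-/

noncomputable section
namespace Voting

/-! ### Product weights on finite databases -/

section Moments

variable {U : Type*} [Fintype U]

theorem sum_fin_succ_fun {β : Type*} [AddCommMonoid β] {n : ℕ} (i : Fin (n + 1))
    (F : (Fin (n + 1) → U) → β) :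
    ∑ D, F D = ∑ u, ∑ D', F (i.insertNth u D') := by
  rw [← (Fin.insertNthEquiv (fun _ => U) i).sum_comp F, Fintype.sum_prod_type]
  rfl

theorem sum_prod_weight (q : U → ℝ) (hq : ∑ u, q u = 1) (n : ℕ) :
    ∑ D : Fin n → U, ∏ i, q (D i) = 1 := by
  classical
  have h := Finset.sum_prod_piFinset (ι := Fin n) (Finset.univ : Finset U) (fun _ u => q u)
  rw [Fintype.piFinset_univ] at h
  rw [h]
  simp [hq]

theorem sum_weight_mul_sum (q g : U → ℝ) (hq : ∑ u, q u = 1) (hg : ∑ u, q u * g u = 0) (n : ℕ) :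
    ∑ D : Fin n → U, (∏ i, q (D i)) * ∑ i, g (D i) = 0 := by
  induction n with
  | zero => simp
  | succ n ih =>
    rw [sum_fin_succ_fun 0]
    have h1 : ∀ u (D' : Fin n → U), (∏ i, q (Fin.insertNth (α := fun _ => U) 0 u D' i)) *
        ∑ i, g (Fin.insertNth (α := fun _ => U) 0 u D' i) =
        (q u * g u) * (∏ i, q (D' i)) + q u * ((∏ i, q (D' i)) * ∑ i, g (D' i)) := by
      intro u D'
      simp [Fin.prod_univ_succ, Fin.sum_univ_succ]
      ring
    simp only [h1, Finset.sum_add_distrib, ← Finset.mul_sum, sum_prod_weight q hq, ih, mul_zero,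
      mul_one, hg, add_zero]

/-- The variance of a sum of independent centred terms is the sum of the variances. -/
theorem sum_weight_mul_sq (q g : U → ℝ) (hq : ∑ u, q u = 1) (hg : ∑ u, q u * g u = 0) (n : ℕ) :
    ∑ D : Fin n → U, (∏ i, q (D i)) * (∑ i, g (D i)) ^ 2 = n * ∑ u, q u * g u ^ 2 := by
  induction n with
  | zero => simp
  | succ n ih =>
    rw [sum_fin_succ_fun 0]
    have h1 : ∀ u (D' : Fin n → U), (∏ i, q (Fin.insertNth (α := fun _ => U) 0 u D' i)) *
        (∑ i, g (Fin.insertNth (α := fun _ => U) 0 u D' i)) ^ 2 =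
        (q u * g u ^ 2) * (∏ i, q (D' i)) +
        (2 * (q u * g u)) * ((∏ i, q (D' i)) * ∑ i, g (D' i)) +
        q u * ((∏ i, q (D' i)) * (∑ i, g (D' i)) ^ 2) := by
      intro u D'
      simp [Fin.prod_univ_succ, Fin.sum_univ_succ]
      ring
    simp only [h1, Finset.sum_add_distrib, ← Finset.mul_sum, ← Finset.sum_mul,
      sum_prod_weight q hq, ih, sum_weight_mul_sum q g hq hg, hg, hq]
    push_cast
    ring

end Moments

section Histograms

variable {m : ℕ}

theorem hist_eq_sum {n : ℕ} (D : Fin n → Ranking m) (V : Ranking m) :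
    (hist D V : ℝ) = ∑ i, if D i = V then (1 : ℝ) else 0 := by
  simp [hist]

theorem numVotes_hist {n : ℕ} (D : Fin n → Ranking m) : numVotes (hist D) = n := by
  have h := Finset.card_eq_sum_card_fiberwise (f := D) (s := Finset.univ) (t := Finset.univ)
    (fun _ _ => Finset.mem_coe.2 (Finset.mem_univ _))
  simpa [numVotes, hist] using h.symm

theorem hist_insertNth {n : ℕ} (i : Fin (n + 1)) (x : Ranking m) (D : Fin n → Ranking m) :
    hist (i.insertNth x D : Fin (n + 1) → Ranking m) = hist D + Pi.single x 1 := by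
  funext V
  have h : ((hist (i.insertNth x D : Fin (n + 1) → Ranking m) V : ℕ) : ℝ) =
      ((hist D + Pi.single x 1 : Profile m) V : ℕ) := by
    rw [hist_eq_sum, Fin.sum_univ_succAbove _ i]
    simp only [Fin.insertNth_apply_same, Fin.insertNth_apply_succAbove, Pi.add_apply,
      Nat.cast_add, hist_eq_sum]
    rw [add_comm]
    congr 1
    rw [Pi.single_apply]
    by_cases h : x = V
    · simp [h]
    · simp [h, Ne.symm h]
  exact_mod_cast h

theorem hist_comp {n : ℕ} (D : Fin n → Ranking m) (e : Equiv.Perm (Ranking m)) :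
    hist (fun i => e (D i)) = fun V => hist D (e.symm V) := by
  funext V
  simp [hist, Equiv.eq_symm_apply]

/-- Counting votes for `x` in all databases amounts to fixing one row at `x`. -/
theorem sum_hist_mul {n : ℕ} (x : Ranking m) (F : Profile m → ℝ) :
    ∑ D : Fin (n + 1) → Ranking m, (hist D x : ℝ) * F (hist D) =
      (n + 1) * ∑ D : Fin n → Ranking m, F (hist D + Pi.single x 1) := by
  simp only [hist_eq_sum, Finset.sum_mul]
  rw [Finset.sum_comm]
  have h : ∀ i : Fin (n + 1), ∑ D : Fin (n + 1) → Ranking m,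
      (if D i = x then (1 : ℝ) else 0) * F (hist D) =
      ∑ D : Fin n → Ranking m, F (hist D + Pi.single x 1) := by
    intro i
    rw [sum_fin_succ_fun i]
    simp [hist_insertNth]
  rw [Finset.sum_congr rfl fun i _ => h i]
  simp

/-- The second moment of the difference of two histogram cells bounds the correlation of a
`[0, 1]`-valued function with it. -/
theorem sum_hist_sub_mul_le {n : ℕ} (x x' : Ranking m) (F : Profile m → ℝ)
    (h0 : ∀ P, 0 ≤ F P) (h1 : ∀ P, F P ≤ 1) :
    ∑ D : Fin n → Ranking m, ((hist D x : ℝ) - hist D x') * F (hist D) ≤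
      (Fintype.card (Ranking m) : ℝ) ^ n * Real.sqrt (2 * n) := by
  set N : ℝ := ((Fintype.card (Ranking m) : ℕ) : ℝ) with hN
  have hNpos : 0 < N := by rw [hN]; exact_mod_cast Fintype.card_pos
  have hN1 : 1 ≤ N := by rw [hN]; exact_mod_cast Fintype.card_pos
  set g : Ranking m → ℝ := fun V => (if V = x then 1 else 0) - (if V = x' then 1 else 0) with hg
  have hgs : ∀ D : Fin n → Ranking m, (hist D x : ℝ) - hist D x' = ∑ i, g (D i) := by
    intro D
    simp [hist_eq_sum, hg]
  have hq : ∑ _u : Ranking m, (1 / N) = 1 := by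
    simp [← hN, hNpos.ne']
  have hq2 : ∑ u : Ranking m, (1 / N) * g u = 0 := by
    rw [← Finset.mul_sum]
    simp [hg]
  have hg2 : ∑ u : Ranking m, (1 / N) * g u ^ 2 ≤ 2 := by
    rw [← Finset.mul_sum]
    have : ∑ u : Ranking m, g u ^ 2 ≤
        ∑ u : Ranking m, ((if u = x then (1 : ℝ) else 0) + (if u = x' then 1 else 0)) := by
      refine Finset.sum_le_sum fun u _ => ?_
      simp only [hg]
      split_ifs <;> norm_num
    rw [Finset.sum_add_distrib] at this
    simp only [Finset.sum_ite_eq', Finset.mem_univ, if_true] at this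
    calc 1 / N * ∑ u : Ranking m, g u ^ 2 ≤ 1 * 2 := by
          gcongr
          · rw [div_le_one hNpos]; exact hN1
          · linarith
      _ = 2 := one_mul _
  have hm := sum_weight_mul_sq (fun _ : Ranking m => 1 / N) g hq hq2 n
  simp only [Finset.prod_const, Finset.card_univ, Fintype.card_fin, ← Finset.mul_sum] at hm
  have hsq : ∑ D : Fin n → Ranking m, (∑ i, g (D i)) ^ 2 ≤ N ^ n * (2 * n) := by
    have h3 : (1 / N) ^ n * ∑ D : Fin n → Ranking m, (∑ i, g (D i)) ^ 2 ≤ n * 2 := by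
      rw [hm]
      gcongr
      rw [Finset.mul_sum]
      exact hg2
    rw [one_div, inv_pow, inv_mul_le_iff₀ (by positivity)] at h3
    linarith
  have hcard : (Fintype.card (Fin n → Ranking m) : ℝ) = N ^ n := by
    simp [hN]
  have hcs := sq_sum_le_card_mul_sum_sq (s := (Finset.univ : Finset (Fin n → Ranking m)))
    (f := fun D => |∑ i, g (D i)|)
  simp only [sq_abs, Finset.card_univ, hcard] at hcs
  calc ∑ D : Fin n → Ranking m, ((hist D x : ℝ) - hist D x') * F (hist D)
      ≤ ∑ D : Fin n → Ranking m, |∑ i, g (D i)| := by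
        refine Finset.sum_le_sum fun D _ => ?_
        rw [hgs]
        calc (∑ i, g (D i)) * F (hist D) ≤ |∑ i, g (D i)| * F (hist D) := by
              gcongr
              · exact h0 _
              · exact le_abs_self _
          _ ≤ |∑ i, g (D i)| * 1 := by gcongr; exact h1 _
          _ = _ := mul_one _
    _ ≤ N ^ n * Real.sqrt (2 * n) := by
        refine abs_le_of_sq_le_sq' ?_ (by positivity) |>.2
        rw [mul_pow, Real.sq_sqrt (by positivity)]
        calc _ ≤ N ^ n * ∑ D : Fin n → Ranking m, (∑ i, g (D i)) ^ 2 := hcs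
          _ ≤ N ^ n * (N ^ n * (2 * n)) := by gcongr
          _ = _ := by ring

/-- The databases in which `x` exceeds and `x'` falls short of the uniform share of the votes by
more than the deviations of all other rankings together. -/
def Tilted {n : ℕ} (x x' : Ranking m) (D : Fin n → Ranking m) : Prop :=
  (∀ V, V ≠ x → V ≠ x' →
    |(hist D V : ℝ) - n / Fintype.card (Ranking m)| ≤ 2 * Real.sqrt n) ∧
  (2 * (Fintype.card (Ranking m) : ℝ) + 2) * Real.sqrt n ≤
    hist D x - n / Fintype.card (Ranking m) ∧
  hist D x' - n / Fintype.card (Ranking m) ≤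
    -((2 * (Fintype.card (Ranking m) : ℝ) + 2) * Real.sqrt n)

open Classical in
/-- A positive fraction of all databases is tilted. Under the product weights that shift the
probabilities of `x` and `x'` by `± ρ/√n`, Chebyshev's inequality makes the tilted databases
typical, and on typical databases these weights exceed the uniform ones by a bounded factor only. -/
theorem exists_tilted_fraction (x x' : Ranking m) (hxx : x ≠ x') :
    ∃ c : ℝ, 0 < c ∧ ∀ᶠ n : ℕ in atTop,
      c * (Fintype.card (Ranking m) : ℝ) ^ n ≤
        (Finset.univ.filter (fun D : Fin n → Ranking m => Tilted x x' D)).card := by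
  set N : ℝ := ((Fintype.card (Ranking m) : ℕ) : ℝ) with hN
  have hNpos : 0 < N := by rw [hN]; exact_mod_cast Fintype.card_pos
  -- typical deviations are at most `2 √n`, so this shift of `x` leaves the required `(2 N + 2) √n`
  set ρ : ℝ := 2 * N + 4 with hρ
  have hρpos : 0 < ρ := by positivity
  refine ⟨Real.exp (-(N * ρ * (2 * ρ + 4))) / 2, by positivity, ?_⟩
  have hlim : ∀ᶠ n : ℕ in atTop, N * ρ ≤ Real.sqrt n :=
    (Real.tendsto_sqrt_atTop.comp tendsto_natCast_atTop_atTop).eventually_ge_atTop (N * ρ)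
  filter_upwards [hlim, eventually_gt_atTop 0] with n hn hn0
  have hn0' : (0 : ℝ) < n := by exact_mod_cast hn0
  set t : ℝ := Real.sqrt n with ht
  have htpos : 0 < t := Real.sqrt_pos.2 hn0'
  have htt : t * t = n := Real.mul_self_sqrt hn0'.le
  set s : ℝ := N * ρ / t with hs
  have hs0 : 0 ≤ s := by positivity
  have hs1 : s ≤ 1 := by rw [hs, div_le_one htpos]; exact hn
  set g : Ranking m → ℝ := fun V => (if V = x then 1 else 0) - (if V = x' then 1 else 0) with hg
  have hg1 : ∀ V, -1 ≤ g V := by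
    intro V; simp only [hg]; split_ifs <;> norm_num
  set q : Ranking m → ℝ := fun V => (1 + s * g V) / N with hqdef
  have hqnn : ∀ V, 0 ≤ q V := by
    intro V
    have := hg1 V
    have : 0 ≤ 1 + s * g V := by nlinarith
    positivity
  have hgsum : ∑ V, g V = 0 := by simp [hg]
  have hq : ∑ V, q V = 1 := by
    simp only [hqdef, ← Finset.sum_div, Finset.sum_add_distrib, ← Finset.mul_sum, hgsum]
    simp [← hN, hNpos.ne']
  set w : (Fin n → Ranking m) → ℝ := fun D => ∏ i, q (D i) with hw
  have hwnn : ∀ D, 0 ≤ w D := fun D => Finset.prod_nonneg fun i _ => hqnn _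
  -- the variance of each cell under the tilted weights
  have hvar : ∀ V, ∑ D, w D * ((hist D V : ℝ) - n * q V) ^ 2 ≤ n * q V := by
    intro V
    have hc : ∑ u, q u * ((if u = V then (1 : ℝ) else 0) - q V) = 0 := by
      simp [mul_sub, Finset.sum_sub_distrib, ← Finset.sum_mul, hq]
    have h := sum_weight_mul_sq q (fun u => (if u = V then (1 : ℝ) else 0) - q V) hq hc n
    have e1 : ∀ D : Fin n → Ranking m,
        ∑ i, ((if D i = V then (1 : ℝ) else 0) - q V) = (hist D V : ℝ) - n * q V := by
      intro D
      rw [hist_eq_sum]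
      simp [Finset.sum_sub_distrib]
    simp only [e1] at h
    rw [h]
    gcongr
    have e2 : ∀ u, q u * ((if u = V then (1 : ℝ) else 0) - q V) ^ 2 =
        (if u = V then q u else 0) - 2 * q V * (if u = V then q u else 0) + q V ^ 2 * q u := by
      intro u; split_ifs <;> ring
    simp only [e2, Finset.sum_add_distrib, Finset.sum_sub_distrib, ← Finset.mul_sum, hq]
    simp
    nlinarith [sq_nonneg (q V)]
  set T : Finset (Fin n → Ranking m) :=
    Finset.univ.filter (fun D => ∀ V, |(hist D V : ℝ) - n * q V| ≤ 2 * t) with hT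
  -- Chebyshev's inequality and the union bound
  have hbad : ∑ D ∈ Tᶜ, w D ≤ 1 / 4 := by
    have h1 : ∀ D ∈ Tᶜ, w D * (4 * n) ≤ ∑ V, w D * ((hist D V : ℝ) - n * q V) ^ 2 := by
      intro D hD
      have : ∃ V, 2 * t < |(hist D V : ℝ) - n * q V| := by simpa [hT] using hD
      obtain ⟨V, hV⟩ := this
      refine le_trans ?_ (Finset.single_le_sum
        (f := fun V => w D * ((hist D V : ℝ) - n * q V) ^ 2)
        (fun V _ => mul_nonneg (hwnn D) (sq_nonneg _)) (Finset.mem_univ V))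
      have : (2 * t) ^ 2 ≤ ((hist D V : ℝ) - n * q V) ^ 2 := by
        rw [← sq_abs ((hist D V : ℝ) - n * q V)]
        gcongr
      have h4 : (4 * n : ℝ) = (2 * t) ^ 2 := by rw [← htt]; ring
      rw [h4]
      exact mul_le_mul_of_nonneg_left this (hwnn D)
    have h2 : (∑ D ∈ Tᶜ, w D) * (4 * n) ≤ n := by
      rw [Finset.sum_mul]
      calc ∑ D ∈ Tᶜ, w D * (4 * n)
          ≤ ∑ D ∈ Tᶜ, ∑ V, w D * ((hist D V : ℝ) - n * q V) ^ 2 := Finset.sum_le_sum h1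
        _ ≤ ∑ D, ∑ V, w D * ((hist D V : ℝ) - n * q V) ^ 2 :=
            Finset.sum_le_univ_sum_of_nonneg fun D =>
              Finset.sum_nonneg fun V _ => mul_nonneg (hwnn D) (sq_nonneg _)
        _ = ∑ V, ∑ D, w D * ((hist D V : ℝ) - n * q V) ^ 2 := Finset.sum_comm
        _ ≤ ∑ V, n * q V := Finset.sum_le_sum fun V _ => hvar V
        _ = n := by rw [← Finset.mul_sum, hq, mul_one]
    by_contra hcon
    push Not at hcon
    nlinarith
  have hgood : 1 / 2 ≤ ∑ D ∈ T, w D := by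
    have h1 := Finset.sum_add_sum_compl T w
    have h2 : ∑ D, w D = 1 := sum_prod_weight q hq n
    linarith
  have hnq : ∀ V, n * q V = n / N + ρ * t * g V := by
    intro V
    simp only [hqdef, hs]
    field_simp
    linear_combination (-(N * ρ * g V)) * htt
  have hgx : g x = 1 := by simp [hg, hxx]
  have hgx' : g x' = -1 := by simp [hg, hxx.symm]
  have hsub : T ⊆ Finset.univ.filter (fun D : Fin n → Ranking m => Tilted x x' D) := by
    intro D hD
    have hD' : ∀ V, |(hist D V : ℝ) - n * q V| ≤ 2 * t := by simpa [hT] using hD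
    refine Finset.mem_filter.2 ⟨Finset.mem_univ _, ?_, ?_, ?_⟩
    · intro V h1 h2
      have h3 := hD' V
      rw [hnq] at h3
      simpa [hg, h1, h2] using h3
    · have h3 := (abs_le.1 (hD' x)).1
      rw [hnq, hgx] at h3
      simp only [← hN, ← ht]
      nlinarith
    · have h3 := (abs_le.1 (hD' x')).2
      rw [hnq, hgx'] at h3
      simp only [← hN, ← ht]
      nlinarith
  -- the density of the tilted weights is bounded on typical databases
  have hdens : ∀ D ∈ T, w D ≤ Real.exp (N * ρ * (2 * ρ + 4)) / N ^ n := by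
    intro D hD
    have hD' : ∀ V, |(hist D V : ℝ) - n * q V| ≤ 2 * t := by simpa [hT] using hD
    have hgs : ∑ i, g (D i) = (hist D x : ℝ) - hist D x' := by
      simp [hist_eq_sum, hg]
    have h1 : w D = (∏ i, (1 + s * g (D i))) / N ^ n := by
      simp [hw, hqdef, Finset.prod_div_distrib]
    rw [h1]
    gcongr
    calc ∏ i, (1 + s * g (D i)) ≤ ∏ i, Real.exp (s * g (D i)) := by
          refine Finset.prod_le_prod (fun i _ => ?_) (fun i _ => ?_)
          · nlinarith [hg1 (D i)]
          · rw [add_comm]; exact Real.add_one_le_exp _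
      _ = Real.exp (s * ((hist D x : ℝ) - hist D x')) := by
          rw [← Real.exp_sum, ← Finset.mul_sum, hgs]
      _ ≤ Real.exp (N * ρ * (2 * ρ + 4)) := by
          rw [Real.exp_le_exp]
          have h3 := (abs_le.1 (hD' x)).2
          have h4 := (abs_le.1 (hD' x')).1
          rw [hnq, hgx] at h3
          rw [hnq, hgx'] at h4
          have h5 : (hist D x : ℝ) - hist D x' ≤ (2 * ρ + 4) * t := by linarith
          calc s * ((hist D x : ℝ) - hist D x') ≤ s * ((2 * ρ + 4) * t) := by gcongr
            _ = N * ρ * (2 * ρ + 4) := by rw [hs]; field_simp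
  have hcardT : (1 : ℝ) / 2 ≤ T.card * (Real.exp (N * ρ * (2 * ρ + 4)) / N ^ n) := by
    refine hgood.trans ((Finset.sum_le_sum hdens).trans ?_)
    simp
  have hTle : (T.card : ℝ) ≤
      (Finset.univ.filter (fun D : Fin n → Ranking m => Tilted x x' D)).card := by
    exact_mod_cast Finset.card_le_card hsub
  refine le_trans ?_ hTle
  rw [Real.exp_neg]
  have he := Real.exp_pos (N * ρ * (2 * ρ + 4))
  have hNn : 0 < N ^ n := by positivity
  rw [mul_div_assoc', div_le_div_iff₀ (by norm_num) hNn] at hcardT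
  rw [div_mul_eq_mul_div, div_le_iff₀ (by norm_num), inv_mul_le_iff₀ he]
  linarith

end Histograms

/-! ### Comparing profiles -/

section Comparison

variable {m : ℕ}

/-- The number of votes with the property `w`. -/
def votesWith (w : Ranking m → Prop) [DecidablePred w] (P : Profile m) : ℕ :=
  ∑ V, if w V then P V else 0

theorem sum_eq_add_add_sum_compl {x x' : Ranking m} (hxx : x ≠ x') (F : Ranking m → ℝ) :
    ∑ V, F V = F x + F x' + ∑ V ∈ (Finset.univ.erase x).erase x', F V := by
  rw [← Finset.add_sum_erase _ _ (Finset.mem_univ x), add_assoc,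
    Finset.add_sum_erase _ _ (Finset.mem_erase.2 ⟨hxx.symm, Finset.mem_univ _⟩)]

theorem votesWith_eq_sum (w : Ranking m → Prop) [DecidablePred w] (P : Profile m) :
    (votesWith w P : ℝ) = ∑ V, (if w V then (1 : ℝ) else 0) * P V := by
  simp [votesWith]

theorem votesWith_not (w : Ranking m → Prop) [DecidablePred w] (P : Profile m) :
    votesWith (fun V => ¬ w V) P + votesWith w P = numVotes P := by
  rw [votesWith, votesWith, ← Finset.sum_add_distrib]
  exact Finset.sum_congr rfl fun V _ => by by_cases h : w V <;> simp [h]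

/-- Moving the surplus of votes for `x` over those for `x'` from `x` to `x'` cannot increase a count
that includes `x` whenever it includes `x'`. -/
theorem votesWith_swap_le {x x' : Ranking m} (P : Profile m) (hP : P x' ≤ P x)
    (w : Ranking m → Prop) [DecidablePred w] (hw : w x' → w x) :
    votesWith w (fun V => P (Equiv.swap x x' V)) ≤ votesWith w P := by
  rcases eq_or_ne x x' with rfl | hxx
  · simp
  have hP' : (P x' : ℝ) ≤ P x := by exact_mod_cast hP
  have h : (votesWith w (fun V => P (Equiv.swap x x' V)) : ℝ) ≤ votesWith w P := by
    rw [votesWith_eq_sum, votesWith_eq_sum, sum_eq_add_add_sum_compl hxx,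
      sum_eq_add_add_sum_compl hxx]
    refine add_le_add ?_ (Finset.sum_le_sum fun V hV => ?_)
    · simp only [Equiv.swap_apply_left, Equiv.swap_apply_right]
      by_cases h1 : w x' <;> by_cases h2 : w x <;> simp_all [add_comm]
    · simp only [Finset.mem_erase, Finset.mem_univ, and_true] at hV
      rw [Equiv.swap_apply_of_ne_of_ne hV.2 hV.1]
  exact_mod_cast h

theorem le_votesWith_swap {x x' : Ranking m} (P : Profile m) (hP : P x' ≤ P x)
    (w : Ranking m → Prop) [DecidablePred w] (hw : w x → w x') :
    votesWith w P ≤ votesWith w (fun V => P (Equiv.swap x x' V)) := by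
  have h := votesWith_swap_le (x := x') (x' := x) (fun V => P (Equiv.swap x x' V))
    (by simpa using hP) w hw
  simpa [Equiv.swap_comm x' x] using h

theorem votesWith_swap_eq {x x' : Ranking m} (P : Profile m) (hP : P x' ≤ P x)
    (w : Ranking m → Prop) [DecidablePred w] (hw : w x ↔ w x') :
    votesWith w P = votesWith w (fun V => P (Equiv.swap x x' V)) :=
  le_antisymm (le_votesWith_swap P hP w hw.1) (votesWith_swap_le P hP w hw.2)

/-- Two counts over equally many rankings differ in the way that `x` and `x'` dictate, as soon as
the deviations of `P` at `x` and `x'` from a constant outweigh those at all other rankings. -/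
theorem votesWith_lt_votesWith {x x' : Ranking m} (hxx : x ≠ x') (P : Profile m) (B r R : ℝ)
    (hr : 0 ≤ r) (hR : Fintype.card (Ranking m) * r < R)
    (hP : ∀ V, V ≠ x → V ≠ x' → |(P V : ℝ) - B| ≤ r) (hx : R ≤ P x - B) (hx' : P x' - B ≤ -R)
    (w w₁ : Ranking m → Prop) [DecidablePred w] [DecidablePred w₁]
    (hcard : (Finset.univ.filter w).card = (Finset.univ.filter w₁).card)
    (h1 : w₁ x) (h2 : ¬ w₁ x') (h3 : w x → w x') : votesWith w P < votesWith w₁ P := by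
  have hc : ∑ V, ((if w₁ V then (1 : ℝ) else 0) - (if w V then 1 else 0)) = 0 := by
    rw [Finset.sum_sub_distrib]
    simp [hcard]
  have hR0 : 0 ≤ R := le_trans (by positivity) hR.le
  have hkey : (votesWith w₁ P : ℝ) - votesWith w P =
      ∑ V, ((if w₁ V then (1 : ℝ) else 0) - (if w V then 1 else 0)) * (P V - B) := by
    have hB : ∑ V, ((if w₁ V then (1 : ℝ) else 0) - (if w V then 1 else 0)) * B = 0 := by
      rw [← Finset.sum_mul, hc, zero_mul]
    simp only [mul_sub (_ - _) (_ : ℝ) B]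
    rw [Finset.sum_sub_distrib, hB, sub_zero, votesWith_eq_sum, votesWith_eq_sum,
      ← Finset.sum_sub_distrib]
    exact Finset.sum_congr rfl fun V _ => (sub_mul _ _ _).symm
  have hrest : -(Fintype.card (Ranking m) * r) ≤ ∑ V ∈ (Finset.univ.erase x).erase x',
      ((if w₁ V then (1 : ℝ) else 0) - (if w V then 1 else 0)) * (P V - B) := by
    have hcle : (((Finset.univ.erase x).erase x').card : ℝ) ≤ Fintype.card (Ranking m) := by
      exact_mod_cast Finset.card_le_univ _
    calc -(Fintype.card (Ranking m) * r)
        ≤ ∑ V ∈ (Finset.univ.erase x).erase x', (-r) := by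
          rw [Finset.sum_const, nsmul_eq_mul]
          nlinarith
      _ ≤ _ := by
          refine Finset.sum_le_sum fun V hV => ?_
          simp only [Finset.mem_erase, Finset.mem_univ, and_true] at hV
          have h := abs_le.1 (hP V hV.2 hV.1)
          split_ifs <;> simp <;> linarith
  have hmain : R ≤ ((if w₁ x then (1 : ℝ) else 0) - (if w x then 1 else 0)) * (P x - B) +
      ((if w₁ x' then (1 : ℝ) else 0) - (if w x' then 1 else 0)) * (P x' - B) := by
    by_cases h4 : w x
    · simp [h1, h2, h4, h3 h4]; linarith
    · by_cases h5 : w x' <;> simp [h1, h2, h4, h5] <;> linarith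
  have : (votesWith w P : ℝ) < votesWith w₁ P := by
    rw [← sub_pos, hkey, sum_eq_add_add_sum_compl hxx]
    linarith
  exact_mod_cast this

/-- Two pairs of distinct candidates are related by a permutation of the candidates. -/
theorem exists_perm_pair {a b c d : Fin m} (hab : a ≠ b) (hcd : c ≠ d) :
    ∃ e : Equiv.Perm (Fin m), e a = c ∧ e b = d := by
  have h : Equiv.swap a c b ≠ c := by
    intro h
    have := (Equiv.swap a c).injective (h.trans (Equiv.swap_apply_left a c).symm)
    exact hab this.symm
  refine ⟨(Equiv.swap a c).trans (Equiv.swap (Equiv.swap a c b) d), ?_, ?_⟩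
  · simp [Equiv.swap_apply_of_ne_of_ne h.symm hcd]
  · simp

theorem card_filter_pref_eq {a b c d : Fin m} (hab : a ≠ b) (hcd : c ≠ d) :
    (Finset.univ.filter (fun V : Ranking m => V a < V b)).card =
      (Finset.univ.filter (fun V : Ranking m => V c < V d)).card := by
  obtain ⟨e, h1, h2⟩ := exists_perm_pair hab hcd
  refine Finset.card_equiv (Equiv.mulRight e⁻¹) fun V => ?_
  have h3 : e.symm c = a := by rw [← h1]; simp
  have h4 : e.symm d = b := by rw [← h2]; simp
  simp [h3, h4]

theorem card_filter_top_eq (k : ℕ) (a b : Fin m) :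
    (Finset.univ.filter (fun V : Ranking m => (V a : ℕ) < k)).card =
      (Finset.univ.filter (fun V : Ranking m => (V b : ℕ) < k)).card := by
  refine Finset.card_equiv (Equiv.mulRight (Equiv.swap a b)) fun V => ?_
  simp

/-- In `P'` the candidate `a` does at least as well as in `P`, the pairwise comparisons of the other
candidates are the same, and no other candidate gains top-`k` votes. -/
structure Raises (a : Fin m) (P P' : Profile m) : Prop where
  pref_left : ∀ c, prefCount P a c ≤ prefCount P' a c
  pref_right : ∀ c, prefCount P' c a ≤ prefCount P c a
  pref_eq : ∀ c d, c ≠ a → d ≠ a → prefCount P' c d = prefCount P c d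
  top_self : ∀ k, topCount P k a ≤ topCount P' k a
  top_other : ∀ k c, c ≠ a → topCount P' k c ≤ topCount P k c
  numVotes_eq : numVotes P' = numVotes P

/-- The candidate `a` beats all other candidates in every respect: its pairwise counts exceed all
pairwise counts of the others, and it has the most top-`k` votes for each `1 ≤ k < m`. -/
structure IsTop (a : Fin m) (P : Profile m) : Prop where
  pref : ∀ c d e, c ≠ a → d ≠ a → d ≠ e → prefCount P d e < prefCount P a c
  top : ∀ k c, 1 ≤ k → k < m → c ≠ a → topCount P k c < topCount P k a

/-- The candidate `a` is beaten by all other candidates in every respect: its pairwise counts fall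
below all pairwise counts of the others, and it has the fewest top-`k` votes for each
`1 ≤ k < m`. -/
structure IsBottom (a : Fin m) (P : Profile m) : Prop where
  pref : ∀ c d e, c ≠ a → d ≠ a → d ≠ e → prefCount P a c < prefCount P d e
  top : ∀ k c, 1 ≤ k → k < m → c ≠ a → topCount P k a < topCount P k c

/-- The ranking `x` arises from the ranking `x'` by moving `a` from the bottom to the top. -/
structure LiftsToTop (a : Fin m) (x x' : Ranking m) : Prop where
  top : (x a : ℕ) = 0
  bottom : (x' a : ℕ) + 1 = m
  other : ∀ c, c ≠ a → (x' c : ℕ) + 1 = x c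

theorem exists_liftsToTop (a : Fin m) : ∃ x x' : Ranking m, LiftsToTop a x x' := by
  obtain ⟨k, rfl⟩ : ∃ k, m = k + 1 := ⟨m - 1, by have := a.2; omega⟩
  refine ⟨(Equiv.swap a (Fin.last k)).trans (finRotate (k + 1)), Equiv.swap a (Fin.last k),
    ⟨?_, ?_, ?_⟩⟩
  · simp
  · simp
  · intro c hc
    have h : Equiv.swap a (Fin.last k) c ≠ Fin.last k := by
      intro h
      exact hc ((Equiv.swap a (Fin.last k)).injective
        (h.trans (Equiv.swap_apply_left a (Fin.last k)).symm))
    exact (coe_finRotate_of_ne_last h).symm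

namespace LiftsToTop

variable {a : Fin m} {x x' : Ranking m}

theorem ne (h : LiftsToTop a x x') (hm : 2 ≤ m) : x ≠ x' := by
  rintro rfl
  have := h.top
  have := h.bottom
  omega

theorem pref_top (h : LiftsToTop a x x') {c : Fin m} (hc : c ≠ a) : x a < x c := by
  have := h.top
  have := h.other c hc
  rw [Fin.lt_def]; omega

theorem not_pref_bottom (h : LiftsToTop a x x') (c : Fin m) : ¬ x' a < x' c := by
  have := h.bottom
  have := (x' c).2
  rw [Fin.lt_def]; omega

theorem not_pref_top (h : LiftsToTop a x x') (c : Fin m) : ¬ x c < x a := by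
  have := h.top
  rw [Fin.lt_def]; omega

theorem pref_iff (h : LiftsToTop a x x') {c d : Fin m} (hc : c ≠ a) (hd : d ≠ a) :
    x c < x d ↔ x' c < x' d := by
  have := h.other c hc
  have := h.other d hd
  rw [Fin.lt_def, Fin.lt_def]; omega

theorem raises (h : LiftsToTop a x x') (P : Profile m) (hP : P x' ≤ P x) :
    Raises a (fun V => P (Equiv.swap x x' V)) P where
  pref_left c := votesWith_swap_le P hP _ fun h1 => absurd h1 (h.not_pref_bottom c)
  pref_right c := le_votesWith_swap P hP _ fun h1 => absurd h1 (h.not_pref_top c)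
  pref_eq _ _ hc hd := votesWith_swap_eq P hP _ (h.pref_iff hc hd)
  top_self k := votesWith_swap_le P hP _ fun h1 => by
    have := h.top
    omega
  top_other k c hc := le_votesWith_swap P hP _ fun h1 => by
    have := h.other c hc
    omega
  numVotes_eq := (Equiv.sum_comp (Equiv.swap x x') P).symm

theorem isTop (h : LiftsToTop a x x') (hm : 2 ≤ m) (P : Profile m) (B r R : ℝ) (hr : 0 ≤ r)
    (hR : Fintype.card (Ranking m) * r < R)
    (hP : ∀ V, V ≠ x → V ≠ x' → |(P V : ℝ) - B| ≤ r) (hx : R ≤ P x - B) (hx' : P x' - B ≤ -R) :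
    IsTop a P where
  pref c d e hc hd hde := by
    refine votesWith_lt_votesWith (h.ne hm) P B r R hr hR hP hx hx' _ _
      (card_filter_pref_eq hde hc.symm) (h.pref_top hc) (h.not_pref_bottom c) ?_
    rcases eq_or_ne e a with rfl | he
    · exact fun h1 => absurd h1 (h.not_pref_top d)
    · exact (h.pref_iff hd he).1
  top k c hk hkm hc := by
    have h1 := h.top
    have h2 := h.bottom
    have h3 := h.other c hc
    exact votesWith_lt_votesWith (h.ne hm) P B r R hr hR hP hx hx' _ _
      (card_filter_top_eq k c a) (by omega) (by omega) (by omega)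

end LiftsToTop

theorem LiftsToTop.isBottom {a : Fin m} {x x' : Ranking m} (h : LiftsToTop a x x') (hm : 2 ≤ m)
    (P : Profile m) (B r R : ℝ) (hr : 0 ≤ r) (hR : Fintype.card (Ranking m) * r < R)
    (hP : ∀ V, V ≠ x → V ≠ x' → |(P V : ℝ) - B| ≤ r) (hx : P x - B ≤ -R) (hx' : R ≤ P x' - B) :
    IsBottom a P := by
  -- pass to the complementary counts, for which `x` and `x'` exchange their roles
  have key : ∀ (w w₁ : Ranking m → Prop) [DecidablePred w] [DecidablePred w₁],
      (Finset.univ.filter w).card = (Finset.univ.filter w₁).card → w₁ x → ¬ w₁ x' →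
      (w x → w x') → votesWith w₁ P < votesWith w P := by
    intro w w₁ _ _ hcard h1 h2 h3
    have h4 := votesWith_lt_votesWith (h.ne hm).symm P B r R hr hR
      (fun V hV hV' => hP V hV' hV) hx' hx (fun V => ¬ w V) (fun V => ¬ w₁ V)
      (by
        have e1 := Finset.card_filter_add_card_filter_not (s := Finset.univ) w
        have e2 := Finset.card_filter_add_card_filter_not (s := Finset.univ) w₁
        omega) h2 (not_not.2 h1) (fun h5 h6 => h5 (h3 h6))
    have h5 := votesWith_not w P
    have h6 := votesWith_not w₁ P
    omega
  constructor
  · intro c d e hc hd hde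
    refine key _ _ (card_filter_pref_eq hde hc.symm) (h.pref_top hc) (h.not_pref_bottom c) ?_
    rcases eq_or_ne e a with rfl | he
    · exact fun h1 => absurd h1 (h.not_pref_top d)
    · exact (h.pref_iff hd he).1
  · intro k c hk hkm hc
    have h1 := h.top
    have h2 := h.bottom
    have h3 := h.other c hc
    exact key _ _ (card_filter_top_eq k c a) (by omega) (by omega) (by omega)

end Comparison

/-! ### Responsiveness of the voting rules -/

section Rules

variable {m : ℕ}

/-- Raising `a` keeps it among the tied winners, `a` wins when it beats all other candidates in
every respect, and it does not win when it is beaten in every respect. -/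
structure Responsive (r : Rule m) (a : Fin m) : Prop where
  mono : ∀ P P', 0 < numVotes P → Raises a P P' → a ∈ r.winners P → a ∈ r.winners P'
  win : ∀ P, IsTop a P → a ∈ r.winners P
  lose : ∀ P, IsBottom a P → a ∉ r.winners P

theorem mem_winners_scoreRule [NeZero m] {α : Type*} [LinearOrder α] {score : Profile m → Fin m → α}
    {P : Profile m} {a : Fin m} :
    a ∈ (scoreRule score).winners P ↔ ∀ b, score P b ≤ score P a := by
  simp [scoreRule]

theorem exists_ne_of_two_le (hm : 2 ≤ m) (a : Fin m) : ∃ c, c ≠ a :=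
  haveI : Nontrivial (Fin m) := Fin.nontrivial_iff_two_le.2 hm
  exists_ne a

theorem responsive_scoreRule [NeZero m] (hm : 2 ≤ m) {α : Type*} [LinearOrder α]
    {score : Profile m → Fin m → α} {a : Fin m}
    (hself : ∀ P P', Raises a P P' → score P a ≤ score P' a)
    (hother : ∀ P P' c, c ≠ a → Raises a P P' → score P' c ≤ score P c)
    (hwin : ∀ P c, c ≠ a → IsTop a P → score P c ≤ score P a)
    (hlose : ∀ P c, c ≠ a → IsBottom a P → score P a < score P c) :
    Responsive (scoreRule score) a where
  mono P P' _ h ha := by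
    rw [mem_winners_scoreRule] at ha ⊢
    intro b
    rcases eq_or_ne b a with rfl | hb
    · exact le_rfl
    · exact (hother P P' b hb h).trans ((ha b).trans (hself P P' h))
  win P h := by
    rw [mem_winners_scoreRule]
    intro b
    rcases eq_or_ne b a with rfl | hb
    · exact le_rfl
    · exact hwin P b hb h
  lose P h ha := by
    rw [mem_winners_scoreRule] at ha
    obtain ⟨c, hc⟩ := exists_ne_of_two_le hm a
    exact absurd (ha c) (not_le.2 (hlose P c hc h))

/-- A positional score that is a sum of `k`-approval scores. -/
theorem positional_score_eq {s : Fin m → ℝ} {K : Finset ℕ}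
    (hs : ∀ j : Fin m, s j = ∑ k ∈ K, if (j : ℕ) < k then 1 else 0) (P : Profile m) (a : Fin m) :
    ∑ V : Ranking m, (P V : ℝ) * s (V a) = ∑ k ∈ K, (topCount P k a : ℝ) := by
  simp only [hs, Finset.mul_sum, topCount, Nat.cast_sum]
  rw [Finset.sum_comm]
  simp

theorem responsive_positional [NeZero m] (hm : 2 ≤ m) {s : Fin m → ℝ} (K : Finset ℕ)
    (hK : K.Nonempty) (hK1 : ∀ k ∈ K, 1 ≤ k ∧ k < m)
    (hs : ∀ j : Fin m, s j = ∑ k ∈ K, if (j : ℕ) < k then 1 else 0) (a : Fin m) :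
    Responsive (positional s) a := by
  refine responsive_scoreRule hm ?_ ?_ ?_ ?_ <;> simp only [positional_score_eq hs]
  · exact fun P P' h => Finset.sum_le_sum fun k _ => Nat.cast_le.2 (h.top_self k)
  · exact fun P P' c hc h => Finset.sum_le_sum fun k _ => Nat.cast_le.2 (h.top_other k c hc)
  · exact fun P c hc h => Finset.sum_le_sum fun k hk =>
      Nat.cast_le.2 (h.top k c (hK1 k hk).1 (hK1 k hk).2 hc).le
  · exact fun P c hc h => Finset.sum_lt_sum_of_nonempty hK fun k hk =>
      Nat.cast_lt.2 (h.top k c (hK1 k hk).1 (hK1 k hk).2 hc)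

theorem responsive_kApproval [NeZero m] {k : ℕ} (hk : 1 ≤ k) (hkm : k < m) (a : Fin m) :
    Responsive (kApproval k) a :=
  responsive_positional (by omega) {k} (by simp) (by simp; omega)
    (fun j => (Finset.sum_singleton _ _).symm) a

theorem responsive_plurality [NeZero m] (hm : 2 ≤ m) (a : Fin m) : Responsive plurality a :=
  responsive_positional hm {1} (by simp) (by simp; omega)
    (fun j => by rw [Finset.sum_singleton]; simp only [Nat.lt_one_iff]) a

theorem responsive_veto [NeZero m] (hm : 2 ≤ m) (a : Fin m) : Responsive veto a :=
  responsive_positional hm {m - 1} (by simp) (by simp; omega) (fun j => by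
    have := j.2
    rw [Finset.sum_singleton]
    split_ifs <;> first | rfl | omega) a

theorem responsive_borda [NeZero m] (hm : 2 ≤ m) (a : Fin m) : Responsive borda a :=
  responsive_positional hm (Finset.Ico 1 m) (by simp; omega) (by simp) (fun j => by
    have hj := j.2
    have h : (Finset.Ico 1 m).filter (fun k => (j : ℕ) < k) = Finset.Ico ((j : ℕ) + 1) m := by
      ext k; simp; omega
    rw [Finset.sum_boole, h, Nat.card_Ico, Nat.cast_sub hj]
    push_cast
    ring) a

theorem responsive_maximin [NeZero m] (hm : 2 ≤ m) (a : Fin m) : Responsive maximin a := by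
  refine responsive_scoreRule hm ?_ ?_ ?_ ?_
  · exact fun P P' h => Finset.inf_mono_fun fun b _ => Nat.cast_le.2 (h.pref_left b)
  · intro P P' c hc h
    refine Finset.inf_mono_fun fun b _ => Nat.cast_le.2 ?_
    rcases eq_or_ne b a with rfl | hb
    · exact h.pref_right c
    · exact (h.pref_eq c b hc hb).le
  · intro P c hc h
    refine Finset.le_inf fun b hb => ?_
    exact (Finset.inf_le (Finset.mem_erase.2 ⟨hc.symm, Finset.mem_univ _⟩)).trans
      (Nat.cast_le.2 (h.pref b c a (Finset.ne_of_mem_erase hb) hc hc).le)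
  · intro P c hc h
    refine lt_of_le_of_lt (Finset.inf_le (Finset.mem_erase.2 ⟨hc, Finset.mem_univ _⟩))
      ((Finset.lt_inf_iff (ENat.natCast_lt_top _)).2 fun b hb => Nat.cast_lt.2 ?_)
    exact h.pref c c b hc hc (Finset.ne_of_mem_erase hb).symm

theorem responsive_copeland [NeZero m] (hm : 2 ≤ m) {α : ℝ} (h0 : 0 ≤ α) (h1 : α ≤ 1) (a : Fin m) :
    Responsive (copeland α) a := by
  refine responsive_scoreRule hm ?_ ?_ ?_ ?_
  · intro P P' h
    refine Finset.sum_le_sum fun b _ => ?_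
    have := h.pref_left b
    have := h.pref_right b
    split_ifs <;> first | omega | linarith
  · intro P P' c hc h
    refine Finset.sum_le_sum fun b _ => ?_
    rcases eq_or_ne b a with rfl | hb
    · have := h.pref_left c
      have := h.pref_right c
      split_ifs <;> first | omega | linarith
    · rw [h.pref_eq c b hc hb, h.pref_eq b c hb hc]
  · intro P c hc h
    calc _ ≤ ∑ b ∈ Finset.univ.erase c, (1 : ℝ) := by
          refine Finset.sum_le_sum fun b _ => ?_
          split_ifs <;> linarith
      _ = ∑ b ∈ Finset.univ.erase a, (1 : ℝ) := by simp
      _ = _ := by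
          refine Finset.sum_congr rfl fun b hb => ?_
          have hb := Finset.ne_of_mem_erase hb
          rw [if_pos (h.pref b b a hb hb hb)]
  · intro P c hc h
    have hz : ∀ b ∈ Finset.univ.erase a, (if prefCount P b a < prefCount P a b then (1 : ℝ)
        else if prefCount P a b = prefCount P b a then α else 0) = 0 := by
      intro b hb
      have hb := Finset.ne_of_mem_erase hb
      have := h.pref b b a hb hb hb
      rw [if_neg (by omega), if_neg (by omega)]
    rw [Finset.sum_eq_zero hz]
    refine Finset.sum_pos' (fun b _ => by split_ifs <;> linarith)
      ⟨a, Finset.mem_erase.2 ⟨hc.symm, Finset.mem_univ _⟩, ?_⟩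
    rw [if_pos (h.pref c c a hc hc hc)]
    exact one_pos

/-! #### Bucklin -/

theorem topCount_zero (P : Profile m) (c : Fin m) : topCount P 0 c = 0 := by
  simp [topCount]

theorem topCount_all (P : Profile m) (c : Fin m) : topCount P m c = numVotes P := by
  simp [topCount, numVotes]

theorem sum_topCount (P : Profile m) {k : ℕ} (hk : k ≤ m) :
    ∑ c, topCount P k c = k * numVotes P := by
  simp only [topCount, numVotes, Finset.mul_sum]
  rw [Finset.sum_comm]
  refine Finset.sum_congr rfl fun V _ => ?_
  rw [Equiv.sum_comp V (fun j : Fin m => if (j : ℕ) < k then P V else 0),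
    Fin.sum_univ_eq_sum_range (fun j => if j < k then P V else 0), ← Finset.sum_filter]
  have : (Finset.range m).filter (fun j => j < k) = Finset.range k := by
    ext j; simp; omega
  simp [this]

theorem bucklinRound_spec {P : Profile m} {k : ℕ} {c : Fin m}
    (h : numVotes P < 2 * topCount P k c) :
    bucklinRound P ≤ k ∧ ∃ b, numVotes P < 2 * topCount P (bucklinRound P) b :=
  ⟨Nat.sInf_le ⟨c, h⟩, Nat.sInf_mem (s := {k | ∃ a, numVotes P < 2 * topCount P k a}) ⟨k, c, h⟩⟩

/-- If the top `m - 1` counts are not all equal, then Bucklin stops before the last round. -/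
theorem bucklinRound_mem {P : Profile m} {a b : Fin m} (hm : 2 ≤ m)
    (hab : topCount P (m - 1) a < topCount P (m - 1) b) :
    1 ≤ bucklinRound P ∧ bucklinRound P < m := by
  -- the top `m - 1` counts have average `n (m - 1) / m ≥ n / 2`, so the largest one exceeds `n / 2`
  have hmaj : ∃ c, numVotes P < 2 * topCount P (m - 1) c := by
    by_contra! hcon
    have h1 : ∑ c, 2 * topCount P (m - 1) c < ∑ _c : Fin m, numVotes P :=
      Finset.sum_lt_sum (fun c _ => hcon c) ⟨a, Finset.mem_univ _, by have := hcon b; omega⟩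
    rw [← Finset.mul_sum, sum_topCount P (by omega)] at h1
    obtain ⟨k, rfl⟩ : ∃ k, m = k + 2 := ⟨m - 2, by omega⟩
    simp at h1
    nlinarith
  obtain ⟨c, hc⟩ := hmaj
  obtain ⟨h1, b, h2⟩ := bucklinRound_spec hc
  refine ⟨Nat.one_le_iff_ne_zero.2 fun h => ?_, by omega⟩
  rw [h, topCount_zero] at h2
  omega

theorem responsive_bucklin [NeZero m] (hm : 2 ≤ m) (a : Fin m) : Responsive bucklin a where
  mono P P' hP h ha := by
    simp only [bucklin, mem_winners_scoreRule] at ha ⊢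
    have hmaj : numVotes P < 2 * topCount P m a := by rw [topCount_all]; omega
    obtain ⟨-, b, hb⟩ := bucklinRound_spec hmaj
    have ha' : numVotes P' < 2 * topCount P' (bucklinRound P) a := by
      have := ha b
      have := h.top_self (bucklinRound P)
      have := h.numVotes_eq
      omega
    obtain ⟨hle, b', hb'⟩ := bucklinRound_spec ha'
    intro c
    rcases eq_or_ne c a with rfl | hc
    · exact le_rfl
    rcases hle.eq_or_lt with heq | hlt
    · rw [heq]
      exact (h.top_other _ c hc).trans ((ha c).trans (h.top_self _))
    -- an earlier majority is one for `a`, since no other candidate has gained votes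
    · have hno : ∀ d, d ≠ a → 2 * topCount P' (bucklinRound P') d ≤ numVotes P' := by
        intro d hd
        by_contra! hcon
        have h1 := h.top_other (bucklinRound P') d hd
        have h2 := h.numVotes_eq
        have := (bucklinRound_spec (P := P) (k := bucklinRound P') (c := d) (by omega)).1
        omega
      have : b' = a := by
        by_contra hne
        have := hno b' hne
        omega
      subst this
      have := hno c hc
      omega
  win P h := by
    simp only [bucklin, mem_winners_scoreRule]
    obtain ⟨c, hc⟩ := exists_ne_of_two_le hm a
    obtain ⟨h1, h2⟩ := bucklinRound_mem hm (h.top (m - 1) c (by omega) (by omega) hc)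
    intro b
    rcases eq_or_ne b a with rfl | hb
    · exact le_rfl
    · exact (h.top _ b h1 h2 hb).le
  lose P h ha := by
    simp only [bucklin, mem_winners_scoreRule] at ha
    obtain ⟨c, hc⟩ := exists_ne_of_two_le hm a
    obtain ⟨h1, h2⟩ := bucklinRound_mem hm (h.top (m - 1) c (by omega) (by omega) hc)
    exact absurd (ha c) (not_le.2 (h.top _ c h1 h2 hc))

/-! #### Schulze -/

theorem mem_winners_schulze [NeZero m] {P : Profile m} {a : Fin m} :
    a ∈ schulze.winners P ↔ ∀ b, b ≠ a → pathStrength P b a ≤ pathStrength P a b := by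
  simp [schulze]

theorem HasPath.of_raises_to {a : Fin m} {P P' : Profile m} (h : Raises a P P') {t : ℕ}
    {b : Fin m} (hb : b ≠ a) (hp : HasPath P' t b a) : HasPath P t b a := by
  induction hp using Relation.TransGen.head_induction_on with
  | single hab => exact .single ⟨hab.1, hab.2.trans (h.pref_right _)⟩
  | @head b c hbc _ ih =>
    rcases eq_or_ne c a with rfl | hc
    · exact .single ⟨hbc.1, hbc.2.trans (h.pref_right _)⟩
    · exact .head ⟨hbc.1, hbc.2.trans (h.pref_eq b c hb hc).le⟩ (ih hc)

theorem HasPath.raises_from {a : Fin m} {P P' : Profile m} (h : Raises a P P') {t : ℕ}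
    {b : Fin m} (hb : b ≠ a) (hp : HasPath P t a b) : HasPath P' t a b := by
  induction hp with
  | single hab => exact .single ⟨hab.1, hab.2.trans (h.pref_left _)⟩
  | @tail c b _ hcb ih =>
    rcases eq_or_ne c a with rfl | hc
    · exact .single ⟨hcb.1, hcb.2.trans (h.pref_left _)⟩
    · exact (ih hc).tail ⟨hcb.1, hcb.2.trans (h.pref_eq c b hc hb).ge⟩

theorem responsive_schulze [NeZero m] (hm : 2 ≤ m) (a : Fin m) : Responsive schulze a where
  mono P P' _ h ha := by
    rw [mem_winners_schulze] at ha ⊢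
    intro b hb
    have h1 := HasPath.of_raises_to h hb ((le_pathStrength_iff hb).1 le_rfl)
    have h2 := HasPath.raises_from h hb ((le_pathStrength_iff hb.symm).1 le_rfl)
    exact ((le_pathStrength_iff hb).2 h1).trans
      ((ha b hb).trans ((le_pathStrength_iff hb.symm).2 h2))
  win P h := by
    rw [mem_winners_schulze]
    intro b hb
    -- the last link of a path to `a` is weaker than the direct link from `a`
    obtain ⟨c, -, hc⟩ := Relation.TransGen.tail'_iff.1
      ((le_pathStrength_iff (P := P) hb).1 le_rfl)
    exact hc.2.trans ((h.pref b c a hb hc.1 hc.1).le.trans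
      ((le_pathStrength_iff hb.symm).2 (.single ⟨hb.symm, le_rfl⟩)))
  lose P h ha := by
    rw [mem_winners_schulze] at ha
    obtain ⟨b, hb⟩ := exists_ne_of_two_le hm a
    -- the first link of a path from `a` is weaker than the direct link to `a`
    obtain ⟨c, hc, -⟩ := Relation.TransGen.head'_iff.1
      ((le_pathStrength_iff (P := P) hb.symm).1 le_rfl)
    have h1 := h.pref c b a hc.1.symm hb hb
    have h2 : prefCount P b a ≤ pathStrength P b a :=
      (le_pathStrength_iff hb).2 (.single ⟨hb, le_rfl⟩)
    have h3 := ha b hb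
    have h4 := hc.2
    omega

/-! #### Ranked Pairs -/

/-- The strict order in which Ranked Pairs goes through the ordered pairs. -/
def Precedes (τ : Fin m × Fin m ≃ Fin (m * m)) (P : Profile m) (e f : Fin m × Fin m) : Prop :=
  prefCount P f.1 f.2 < prefCount P e.1 e.2 ∨
    (prefCount P f.1 f.2 = prefCount P e.1 e.2 ∧ τ e < τ f)

theorem Precedes.irrefl (τ : Fin m × Fin m ≃ Fin (m * m)) (P : Profile m) (e : Fin m × Fin m) :
    ¬ Precedes τ P e e := by
  simp [Precedes]

theorem Precedes.trans {τ : Fin m × Fin m ≃ Fin (m * m)} {P : Profile m} {e f g : Fin m × Fin m}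
    (h1 : Precedes τ P e f) (h2 : Precedes τ P f g) : Precedes τ P e g := by
  simp only [Precedes, Fin.lt_def] at *
  omega

theorem Precedes.wellFounded (τ : Fin m × Fin m ≃ Fin (m * m)) (P : Profile m) :
    WellFounded (Precedes τ P) :=
  have : IsTrans _ (Precedes τ P) := ⟨fun _ _ _ => Precedes.trans⟩
  have : Std.Irrefl (Precedes τ P) := ⟨Precedes.irrefl τ P⟩
  Finite.wellFounded_of_trans_of_irrefl _

theorem mem_sortedPairs {τ : Fin m × Fin m ≃ Fin (m * m)} {P : Profile m} {e : Fin m × Fin m} :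
    e ∈ sortedPairs τ P ↔ e.1 ≠ e.2 := by
  simp [sortedPairs, List.mem_mergeSort]

theorem pairwise_sortedPairs (τ : Fin m × Fin m ≃ Fin (m * m)) (P : Profile m) :
    (sortedPairs τ P).Pairwise (Precedes τ P) := by
  have h1 : (sortedPairs τ P).Nodup := (List.mergeSort_perm _ _).nodup_iff.2 (Finset.nodup_toList _)
  have h2 := List.pairwise_mergeSort (le := fun e f : Fin m × Fin m =>
      decide (prefCount P f.1 f.2 < prefCount P e.1 e.2 ∨
      (prefCount P f.1 f.2 = prefCount P e.1 e.2 ∧ τ e ≤ τ f)))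
    (by
      intro e f g
      simp only [decide_eq_true_eq, Fin.le_def]
      omega)
    (by
      intro e f
      simp only [Bool.or_eq_true, decide_eq_true_eq, Fin.le_def]
      omega)
    (Finset.univ.filter (fun e : Fin m × Fin m => e.1 ≠ e.2)).toList
  refine (List.Pairwise.and h1 h2).imp fun {e f} h => ?_
  obtain ⟨hne, h⟩ := h
  rw [decide_eq_true_eq] at h
  exact h.imp_right fun h => ⟨h.1, lt_of_le_of_ne h.2 fun h3 => hne (τ.injective h3)⟩

theorem subset_lockStep (L : Finset (Fin m × Fin m)) (e : Fin m × Fin m) : L ⊆ lockStep L e := by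
  unfold lockStep
  split_ifs
  · exact subset_rfl
  · exact Finset.subset_insert _ _

theorem mem_lockStep {L : Finset (Fin m × Fin m)} {e f : Fin m × Fin m} (h : f ∈ lockStep L e) :
    f ∈ L ∨ f = e := by
  unfold lockStep at h
  split_ifs at h
  · exact .inl h
  · exact (Finset.mem_insert.1 h).symm

theorem subset_foldl_lockStep (l : List (Fin m × Fin m)) (L : Finset (Fin m × Fin m)) :
    L ⊆ l.foldl lockStep L := by
  induction l generalizing L with
  | nil => exact subset_rfl
  | cons e l ih => exact (subset_lockStep L e).trans (ih _)

theorem mem_foldl_lockStep {l : List (Fin m × Fin m)} {L : Finset (Fin m × Fin m)}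
    {f : Fin m × Fin m} (h : f ∈ l.foldl lockStep L) : f ∈ L ∨ f ∈ l := by
  induction l generalizing L with
  | nil => exact .inl h
  | cons e l ih =>
    rcases ih h with h | h
    · exact (mem_lockStep h).imp_right fun h => List.mem_cons.2 (.inl h)
    · exact .inr (List.mem_cons_of_mem _ h)

theorem ne_of_mem_lockedPairs {τ : Fin m × Fin m ≃ Fin (m * m)} {P : Profile m}
    {e : Fin m × Fin m} (h : e ∈ lockedPairs τ P) : e.1 ≠ e.2 := by
  rcases mem_foldl_lockStep h with h | h
  · simp at h
  · exact mem_sortedPairs.1 h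

/-- There is a locked pair from `x` to `y` that is considered before `e`. -/
def LockedBefore (τ : Fin m × Fin m ≃ Fin (m * m)) (P : Profile m) (e : Fin m × Fin m)
    (x y : Fin m) : Prop :=
  (x, y) ∈ lockedPairs τ P ∧ Precedes τ P (x, y) e

/-- The locked pairs described without reference to a list: a pair is locked unless the locked
pairs that precede it contain a path back. -/
theorem mem_lockedPairs_iff {τ : Fin m × Fin m ≃ Fin (m * m)} {P : Profile m}
    {e : Fin m × Fin m} (he : e.1 ≠ e.2) :
    e ∈ lockedPairs τ P ↔ ¬ Relation.ReflTransGen (LockedBefore τ P e) e.2 e.1 := by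
  obtain ⟨l₁, l₂, hl⟩ := List.append_of_mem (mem_sortedPairs (τ := τ) (P := P).2 he)
  have hpw := pairwise_sortedPairs τ P
  rw [hl, List.pairwise_append, List.pairwise_cons] at hpw
  obtain ⟨-, ⟨h2, -⟩, h1⟩ := hpw
  have h1 : ∀ f ∈ l₁, Precedes τ P f e := fun f hf => h1 f hf e List.mem_cons_self
  set L := l₁.foldl lockStep ∅ with hL
  have hlock : lockedPairs τ P = l₂.foldl lockStep (lockStep L e) := by
    rw [lockedPairs, hl, List.foldl_append, List.foldl_cons]
  have hLl : ∀ f ∈ L, f ∈ l₁ := fun f hf => by simpa using mem_foldl_lockStep hf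
  have he2 : e ∉ l₂ := fun h => Precedes.irrefl τ P e (h2 e h)
  have heL : e ∉ L := fun h => Precedes.irrefl τ P e (h1 e (hLl e h))
  have hbefore : LockedBefore τ P e = fun x y => (x, y) ∈ L := by
    funext x y
    refine propext ⟨fun h => ?_, fun h => ⟨?_, h1 _ (hLl _ h)⟩⟩
    · obtain ⟨h3, h4⟩ := h
      rw [hlock] at h3
      rcases mem_foldl_lockStep h3 with h3 | h3
      · rcases mem_lockStep h3 with h3 | h3
        · exact h3
        · exact absurd h4 (h3 ▸ Precedes.irrefl τ P _)
      · exact absurd (h4.trans (h2 _ h3)) (Precedes.irrefl τ P _)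
    · rw [hlock]
      exact subset_foldl_lockStep _ _ (subset_lockStep _ _ h)
  rw [hbefore, hlock]
  constructor
  · intro h3 h4
    rcases mem_foldl_lockStep h3 with h3 | h3
    · rw [lockStep, if_pos h4] at h3
      exact heL h3
    · exact he2 h3
  · intro h4
    refine subset_foldl_lockStep _ _ ?_
    rw [lockStep, if_neg h4]
    exact Finset.mem_insert_self _ _

theorem mem_winners_rankedPairs [NeZero m] {τ : Fin m × Fin m ≃ Fin (m * m)} {P : Profile m}
    {a : Fin m} : a ∈ (rankedPairs τ).winners P ↔ ∀ b, (b, a) ∉ lockedPairs τ P := by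
  simp [rankedPairs]

theorem reflTransGen_avoiding {α : Type*} {r s : α → α → Prop} {a x y : α} (hx : x ≠ a)
    (hr : ∀ u v, u ≠ a → r u v → v ≠ a ∧ s u v) (h : Relation.ReflTransGen r x y) :
    y ≠ a ∧ Relation.ReflTransGen s x y := by
  induction h with
  | refl => exact ⟨hx, .refl⟩
  | tail _ hbc ih => exact ⟨(hr _ _ ih.1 hbc).1, ih.2.tail (hr _ _ ih.1 hbc).2⟩

/-- Raising a winner `a` of Ranked Pairs neither changes the locked pairs among the other
candidates nor locks a pair against `a`. -/
theorem lockedPairs_of_raises {τ : Fin m × Fin m ≃ Fin (m * m)} {P P' : Profile m} {a : Fin m}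
    (h : Raises a P P') (ha : ∀ b, (b, a) ∉ lockedPairs τ P) (e : Fin m × Fin m) :
    e.1 ≠ e.2 → (e.1 ≠ a → e.2 ≠ a → (e ∈ lockedPairs τ P ↔ e ∈ lockedPairs τ P')) ∧
      (e.2 = a → e ∉ lockedPairs τ P') := by
  induction e using (Precedes.wellFounded τ P').induction with
  | _ e ih =>
  intro he
  -- no pair against `a` is locked before `e`
  have hinto : ∀ x, ¬ LockedBefore τ P' e x a := fun x hx =>
    (ih (x, a) hx.2 (ne_of_mem_lockedPairs hx.1)).2 rfl hx.1
  constructor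
  · intro h1 h2
    have hprec : ∀ x y, x ≠ a → y ≠ a → (Precedes τ P (x, y) e ↔ Precedes τ P' (x, y) e) := by
      intro x y hx hy
      simp only [Precedes, h.pref_eq x y hx hy, h.pref_eq e.1 e.2 h1 h2]
    rw [mem_lockedPairs_iff he, mem_lockedPairs_iff he]
    refine not_congr ⟨fun hp => ?_, fun hp => ?_⟩
    · refine (reflTransGen_avoiding h2 (fun u v hu huv => ?_) hp).2
      have hv : v ≠ a := fun hv => ha u (hv ▸ huv.1)
      have h3 := (hprec u v hu hv).1 huv.2
      exact ⟨hv, ((ih (u, v) h3 (ne_of_mem_lockedPairs huv.1)).1 hu hv).1 huv.1, h3⟩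
    · refine (reflTransGen_avoiding h2 (fun u v hu huv => ?_) hp).2
      have hv : v ≠ a := fun hv => hinto u (hv ▸ huv)
      exact ⟨hv, ((ih (u, v) huv.2 (ne_of_mem_lockedPairs huv.1)).1 hu hv).2 huv.1,
        (hprec u v hu hv).2 huv.2⟩
  · intro h2
    obtain ⟨d, b⟩ := e
    obtain rfl : b = a := h2
    have hp := not_not.1 ((mem_lockedPairs_iff (P := P) he).not.1 (ha d))
    rw [mem_lockedPairs_iff he, not_not]
    refine Relation.ReflTransGen.mono (fun u v huv => ?_) _ _ hp
    have huv' : u ≠ v := ne_of_mem_lockedPairs huv.1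
    have hv : v ≠ b := fun hv => ha u (hv ▸ huv.1)
    have hle : prefCount P u v ≤ prefCount P' u v := by
      rcases eq_or_ne u b with rfl | hu
      · exact h.pref_left v
      · exact (h.pref_eq u v hu hv).ge
    have h3 : Precedes τ P' (u, v) (d, b) := by
      have h4 := huv.2
      have h5 := h.pref_right d
      simp only [Precedes, Fin.lt_def] at h4 ⊢
      omega
    refine ⟨?_, h3⟩
    rcases eq_or_ne u b with rfl | hu
    -- a path back to the candidate would end in a pair against it
    · rw [mem_lockedPairs_iff huv']
      intro hq
      rcases Relation.ReflTransGen.cases_tail hq with hq | ⟨w, -, hw⟩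
      · exact huv' hq
      · exact hinto w ⟨hw.1, hw.2.trans h3⟩
    · exact ((ih (u, v) h3 huv').1 hu hv).1 huv.1

theorem responsive_rankedPairs [NeZero m] (hm : 2 ≤ m) (τ : Fin m × Fin m ≃ Fin (m * m))
    (a : Fin m) : Responsive (rankedPairs τ) a where
  mono P P' _ h ha := by
    rw [mem_winners_rankedPairs] at ha ⊢
    intro b hb
    exact (lockedPairs_of_raises h ha (b, a) (ne_of_mem_lockedPairs hb)).2 rfl hb
  win P h := by
    rw [mem_winners_rankedPairs]
    intro d hd
    have hda : d ≠ a := ne_of_mem_lockedPairs hd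
    have h1 : (a, d) ∈ lockedPairs τ P := by
      rw [mem_lockedPairs_iff hda.symm]
      intro hq
      rcases Relation.ReflTransGen.cases_tail hq with hq | ⟨c, -, hc⟩
      · exact hda hq.symm
      · have hca : c ≠ a := ne_of_mem_lockedPairs hc.1
        have h2 := h.pref d c a hda hca hca
        have h3 := hc.2
        simp only [Precedes] at h3
        omega
    exact (mem_lockedPairs_iff hda).1 hd (.single ⟨h1, .inl (h.pref d d a hda hda hda)⟩)
  lose P h ha := by
    rw [mem_winners_rankedPairs] at ha
    obtain ⟨c, hc⟩ := exists_ne_of_two_le hm a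
    refine ha c ((mem_lockedPairs_iff hc).2 fun hq => ?_)
    rcases Relation.ReflTransGen.cases_head hq with hq | ⟨d, hd, -⟩
    · exact hc hq.symm
    · have hda : a ≠ d := ne_of_mem_lockedPairs hd.1
      have h2 := h.pref d c a hda.symm hc hc
      have h3 := hd.2
      simp only [Precedes] at h3
      omega

end Rules

/-! ### Privacy parameters of symmetric mechanisms -/

section Parameters

variable {m : ℕ}

theorem isExact_zero_of_iff {Priv : ℝ → ℝ → Prop} {δ₀ : ℝ} (h0 : 0 ≤ δ₀)
    (h : ∀ δ, Priv 0 δ ↔ δ₀ ≤ δ) : IsExact Priv 0 δ₀ := by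
  refine ⟨le_rfl, h0, (h δ₀).2 le_rfl, fun ε' δ' h1 _ h2 h3 h4 => ?_, fun ε' δ' h1 _ h2 => ?_⟩
  · obtain rfl := le_antisymm h2 h1
    exact absurd ((h δ').1 h4) (not_le.2 h3)
  · exact absurd h2 (not_lt.2 h1)

theorem uniformVotes_apply {n : ℕ} (D : Fin n → Ranking m) :
    uniformVotes m n D = ((Fintype.card (Ranking m) : ENNReal)⁻¹) ^ n := by
  simp [uniformVotes, iid]

theorem rowSupp_uniformVotes {n : ℕ} (i : Fin n) (x : Ranking m) :
    RowSupp (uniformVotes m n) i x := by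
  refine ⟨fun _ => x, rfl, ?_⟩
  rw [PMF.mem_support_iff, uniformVotes_apply]
  exact pow_ne_zero _ (ENNReal.inv_ne_zero.2 (ENNReal.natCast_ne_top _))

/-- Given one row of a uniform database, the remaining rows are still uniform. -/
theorem condProb_uniformVotes {R : Type*} {n : ℕ} (M : (Fin (n + 1) → Ranking m) → PMF R)
    (i : Fin (n + 1)) (x : Ranking m) (hx : RowSupp (uniformVotes m (n + 1)) i x) (S : Set R) :
    condProb (uniformVotes m (n + 1)) M i x hx S =
      (∑ D : Fin n → Ranking m, ((M (i.insertNth x D)).toOuterMeasure S).toReal) /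
        (Fintype.card (Ranking m) : ℝ) ^ n := by
  classical
  have hN0 : (Fintype.card (Ranking m) : ENNReal) ≠ 0 := by
    exact_mod_cast Fintype.card_ne_zero
  have hNt : (Fintype.card (Ranking m) : ENNReal) ≠ ⊤ := ENNReal.natCast_ne_top _
  have hind : ∀ u (D : Fin n → Ranking m),
      Set.indicator {D : Fin (n + 1) → Ranking m | D i = x} (uniformVotes m (n + 1))
        (i.insertNth u D) =
      if u = x then ((Fintype.card (Ranking m) : ENNReal)⁻¹) ^ (n + 1) else 0 := by
    intro u D
    rw [Set.indicator_apply, uniformVotes_apply]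
    simp
  have htot : ∑' D, Set.indicator {D : Fin (n + 1) → Ranking m | D i = x}
      (uniformVotes m (n + 1)) D = (Fintype.card (Ranking m) : ENNReal)⁻¹ := by
    rw [tsum_fintype, sum_fin_succ_fun i]
    simp only [hind, Finset.sum_const, Finset.card_univ, Fintype.card_fun, Fintype.card_fin,
      nsmul_eq_mul, mul_ite, mul_zero, Finset.sum_ite_eq', Finset.mem_univ, if_true]
    rw [pow_succ, ← mul_assoc, Nat.cast_pow, ← mul_pow, ENNReal.mul_inv_cancel hN0 hNt, one_pow,
      one_mul]
  have hfil : ∀ D, (uniformVotes m (n + 1)).filter {D | D i = x} hx D =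
      Set.indicator {D : Fin (n + 1) → Ranking m | D i = x} (uniformVotes m (n + 1)) D *
        ((Fintype.card (Ranking m) : ENNReal)⁻¹)⁻¹ := fun D => by
    rw [← htot]
    exact PMF.filter_apply hx D
  rw [condProb, PMF.toOuterMeasure_bind_apply, tsum_fintype, sum_fin_succ_fun i,
    Finset.sum_eq_single x]
  · rw [ENNReal.toReal_sum, Finset.sum_div]
    · refine Finset.sum_congr rfl fun D _ => ?_
      rw [hfil, hind, if_pos rfl, inv_inv, pow_succ, mul_assoc (_ ^ n),
        ENNReal.inv_mul_cancel hN0 hNt, mul_one, ENNReal.toReal_mul, ENNReal.toReal_pow,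
        ENNReal.toReal_inv, ENNReal.toReal_natCast, div_eq_inv_mul, inv_pow]
    · intro D _
      refine ENNReal.mul_ne_top (PMF.apply_ne_top _ _) (ne_top_of_le_ne_top ENNReal.one_ne_top ?_)
      rw [PMF.toOuterMeasure_apply, ← (M (i.insertNth x D)).tsum_coe]
      exact ENNReal.tsum_le_tsum fun c => Set.indicator_le_self _ _ c
  · intro u _ hu
    refine Finset.sum_eq_zero fun D _ => ?_
    rw [hfil, hind, if_neg hu, zero_mul, zero_mul]
  · simp

open Classical in
/-- The probability that the winner lies in `S` when `n` uniform votes and the vote `x` are cast. -/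
def winProb (r : Rule m) (tie : Ranking m) (n : ℕ) (x : Ranking m) (S : Set (Fin m)) : ℝ :=
  (∑ D : Fin n → Ranking m, if r.winner tie (hist D + Pi.single x 1) ∈ S then (1 : ℝ) else 0) /
    (Fintype.card (Ranking m) : ℝ) ^ n

theorem condProb_winnerMechanism (r : Rule m) (tie : Ranking m) {n : ℕ} (i : Fin (n + 1))
    (x : Ranking m) (hx : RowSupp (uniformVotes m (n + 1)) i x) (S : Set (Fin m)) :
    condProb (uniformVotes m (n + 1)) (winnerMechanism r tie (n + 1)) i x hx S =
      winProb r tie n x S := by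
  classical
  rw [condProb_uniformVotes, winProb]
  congr 1
  refine Finset.sum_congr rfl fun D _ => ?_
  rw [winnerMechanism, PMF.toOuterMeasure_pure_apply, hist_insertNth]
  split_ifs <;> simp

theorem isDDP_winnerMechanism_iff (r : Rule m) (tie : Ranking m) (n : ℕ) (δ : ℝ) :
    IsDDP (uniformVotes m (n + 1)) (winnerMechanism r tie (n + 1)) 0 δ ↔
      ∀ x x' S, winProb r tie n x S - winProb r tie n x' S ≤ δ := by
  simp only [IsDDP, condProb_winnerMechanism, Real.exp_zero, one_mul]
  constructor
  · intro h x x' S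
    have := h 0 x x' (rowSupp_uniformVotes 0 x) (rowSupp_uniformVotes 0 x') S
    linarith
  · intro h i x x' _ _ S
    have := h x x' S
    linarith

theorem exists_exact_isDDP (r : Rule m) (tie : Ranking m) (n : ℕ) :
    ∃ δ₀, ∀ δ, IsDDP (uniformVotes m (n + 1)) (winnerMechanism r tie (n + 1)) 0 δ ↔ δ₀ ≤ δ := by
  refine ⟨Finset.univ.sup' Finset.univ_nonempty
    (fun p : Ranking m × Ranking m × Set (Fin m) =>
      winProb r tie n p.1 p.2.2 - winProb r tie n p.2.1 p.2.2), fun δ => ?_⟩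
  rw [isDDP_winnerMechanism_iff, Finset.sup'_le_iff]
  exact ⟨fun h p _ => h _ _ _, fun h x x' S => h (x, x', S) (Finset.mem_univ _)⟩

open Classical in
theorem toReal_toOuterMeasure (Q : PMF (Fin m)) (S : Set (Fin m)) :
    (Q.toOuterMeasure S).toReal = ∑ c ∈ Finset.univ.filter (· ∈ S), (Q c).toReal := by
  rw [PMF.toOuterMeasure_apply_fintype, ENNReal.toReal_sum, Finset.sum_filter]
  · refine Finset.sum_congr rfl fun c _ => ?_
    rw [Set.indicator_apply]
    split_ifs <;> simp
  · intro c _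
    rw [Set.indicator_apply]
    split_ifs
    · exact PMF.apply_ne_top _ _
    · simp

theorem sum_toReal_pmf (Q : PMF (Fin m)) : ∑ c, (Q c).toReal = 1 := by
  rw [← ENNReal.toReal_sum fun c _ => PMF.apply_ne_top _ _,
    (tsum_fintype (fun c => Q c)).symm.trans Q.tsum_coe, ENNReal.toReal_one]

open Classical in
/-- As the other rows do not depend on row `i`, only the law of the simulator's output matters. -/
theorem isSimDDP_winnerMechanism_iff (r : Rule m) (tie : Ranking m) (n : ℕ) (δ : ℝ) :
    IsSimDDP (uniformVotes m (n + 1)) (winnerMechanism r tie (n + 1)) 0 δ ↔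
      ∃ q ∈ stdSimplex ℝ (Fin m), ∀ x S,
        |winProb r tie n x S - ∑ c ∈ Finset.univ.filter (· ∈ S), q c| ≤ δ := by
  have hN : (0 : ℝ) < (Fintype.card (Ranking m) : ℝ) ^ n :=
    pow_pos (by exact_mod_cast Fintype.card_pos) _
  simp only [IsSimDDP, condProb_winnerMechanism, Real.exp_zero, one_mul]
  simp only [condProb_uniformVotes, toReal_toOuterMeasure, Fin.removeNth_insertNth]
  constructor
  · rintro ⟨Sim, h⟩
    refine ⟨fun c => (∑ D : Fin n → Ranking m, (Sim D c).toReal) /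
      (Fintype.card (Ranking m) : ℝ) ^ n, ⟨fun c => by positivity, ?_⟩, fun x S => ?_⟩
    · rw [← Finset.sum_div, Finset.sum_comm, div_eq_one_iff_eq hN.ne']
      simp [sum_toReal_pmf]
    · have h1 := h 0 x (rowSupp_uniformVotes 0 x) S
      rw [← Finset.sum_div, Finset.sum_comm, abs_le]
      constructor <;> linarith [h1.1, h1.2]
  · rintro ⟨q, ⟨hq0, hq1⟩, h⟩
    refine ⟨fun _ => PMF.ofFintype (fun c => ENNReal.ofReal (q c)) (by
      rw [← ENNReal.ofReal_sum_of_nonneg fun c _ => hq0 c, hq1, ENNReal.ofReal_one]),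
      fun i x _ S => ?_⟩
    have h1 := abs_le.1 (h x S)
    have h2 : (∑ _D : Fin n → Ranking m, ∑ c ∈ Finset.univ.filter (· ∈ S),
        (ENNReal.ofReal (q c)).toReal) / (Fintype.card (Ranking m) : ℝ) ^ n =
        ∑ c ∈ Finset.univ.filter (· ∈ S), q c := by
      simp only [ENNReal.toReal_ofReal (hq0 _), Finset.sum_const, Finset.card_univ,
        Fintype.card_fun, Fintype.card_fin, nsmul_eq_mul, Nat.cast_pow]
      rw [mul_div_assoc, mul_div_cancel₀ _ hN.ne']
    simp only [PMF.ofFintype_apply, h2]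
    constructor <;> linarith [h1.1, h1.2]

/-- The best simulator exists by compactness of the simplex of output laws. -/
theorem exists_exact_isSimDDP [NeZero m] (r : Rule m) (tie : Ranking m) (n : ℕ) :
    ∃ δ₀, ∀ δ, IsSimDDP (uniformVotes m (n + 1)) (winnerMechanism r tie (n + 1)) 0 δ ↔
      δ₀ ≤ δ := by
  classical
  set F : (Fin m → ℝ) → ℝ := fun q => Finset.univ.sup' Finset.univ_nonempty
    (fun p : Ranking m × Set (Fin m) =>
      |winProb r tie n p.1 p.2 - ∑ c ∈ Finset.univ.filter (· ∈ p.2), q c|) with hF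
  have hcont : Continuous F := by
    refine Continuous.finset_sup'_apply _ fun p _ => ?_
    fun_prop
  obtain ⟨q, hq, hmin⟩ := (isCompact_stdSimplex ℝ (Fin m)).exists_isMinOn
    ⟨_, single_mem_stdSimplex ℝ (0 : Fin m)⟩ hcont.continuousOn
  have hle : ∀ q δ, F q ≤ δ ↔ ∀ x S,
      |winProb r tie n x S - ∑ c ∈ Finset.univ.filter (· ∈ S), q c| ≤ δ := by
    intro q δ
    rw [hF, Finset.sup'_le_iff]
    exact ⟨fun h x S => h (x, S) (Finset.mem_univ _), fun h p _ => h _ _⟩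
  refine ⟨F q, fun δ => ?_⟩
  rw [isSimDDP_winnerMechanism_iff]
  constructor
  · rintro ⟨q', hq', h⟩
    exact (hmin hq').trans ((hle q' δ).2 h)
  · exact fun h => ⟨q, hq, (hle q δ).1 h⟩

theorem winProb_eq_sum (r : Rule m) (tie : Ranking m) (n : ℕ) (x : Ranking m)
    (S : Set (Fin m)) [DecidablePred (· ∈ S)] :
    winProb r tie n x S = ∑ c ∈ Finset.univ.filter (· ∈ S), winProb r tie n x {c} := by
  simp only [winProb]
  rw [← Finset.sum_div, Finset.sum_comm]
  congr 1
  refine Finset.sum_congr rfl fun D _ => ?_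
  simp [Finset.sum_ite_eq]

theorem winProb_univ (r : Rule m) (tie : Ranking m) (n : ℕ) (x : Ranking m) :
    winProb r tie n x Set.univ = 1 := by
  have hN : (0 : ℝ) < (Fintype.card (Ranking m) : ℝ) ^ n :=
    pow_pos (by exact_mod_cast Fintype.card_pos) _
  rw [winProb, div_eq_one_iff_eq hN.ne']
  simp

theorem winProb_mem_stdSimplex (r : Rule m) (tie : Ranking m) (n : ℕ) (x : Ranking m) :
    (fun c => winProb r tie n x {c}) ∈ stdSimplex ℝ (Fin m) := by
  classical
  refine ⟨fun c => ?_, ?_⟩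
  · unfold winProb
    positivity
  · simpa [winProb_univ] using (winProb_eq_sum r tie n x Set.univ).symm

theorem isTheta_inv_sqrt {δ : ℕ → ℝ} {c C : ℝ} (hc : 0 < c)
    (h1 : ∀ᶠ n : ℕ in atTop, c / Real.sqrt n ≤ δ n)
    (h2 : ∀ᶠ n : ℕ in atTop, δ n ≤ C / Real.sqrt n) :
    δ =Θ[atTop] (fun n : ℕ => 1 / Real.sqrt n) := by
  refine ⟨IsBigO.of_bound C ?_, IsBigO.of_bound c⁻¹ ?_⟩
  · filter_upwards [h1, h2] with n hn1 hn2
    have h0 : 0 ≤ c / Real.sqrt n := by positivity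
    rw [Real.norm_of_nonneg (h0.trans hn1), Real.norm_of_nonneg (by positivity), mul_one_div]
    exact hn2
  · filter_upwards [h1] with n hn1
    have h0 : 0 ≤ c / Real.sqrt n := by positivity
    rw [Real.norm_of_nonneg (h0.trans hn1), Real.norm_of_nonneg (by positivity),
      le_inv_mul_iff₀ hc, mul_one_div]
    exact hn1

/-- Two-sided bounds on the influence of one vote on the law of the winner determine the exact
parameters of both forms of privacy up to constants. -/
theorem isInvSqrtExactDDP_of_bounds [NeZero m] {r : Rule m} {tie : Ranking m} {c C : ℝ}
    (hc : 0 < c)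
    (hupper : ∀ n x x' S, winProb r tie n x S - winProb r tie n x' S ≤
      C / Real.sqrt ((n + 1 : ℕ) : ℝ))
    (hlower : ∃ x x' S, ∀ᶠ n : ℕ in atTop, c / Real.sqrt ((n + 1 : ℕ) : ℝ) ≤
      winProb r tie n x S - winProb r tie n x' S) : IsInvSqrtExactDDP r tie := by
  classical
  obtain ⟨y, y', T, hT⟩ := hlower
  have shift : ∀ {p : ℕ → Prop}, (∀ᶠ n in atTop, p (n + 1)) → ∀ᶠ n in atTop, p n := by
    intro p hp
    exact (eventually_atTop.1 hp).elim fun N hN => eventually_atTop.2 ⟨N + 1, fun n hn => by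
      obtain ⟨k, rfl⟩ : ∃ k, n = k + 1 := ⟨n - 1, by omega⟩
      exact hN k (by omega)⟩
  constructor
  · choose δ hδ using exists_exact_isDDP r tie
    have hle : ∀ n x x' S, winProb r tie n x S - winProb r tie n x' S ≤ δ n := fun n =>
      (isDDP_winnerMechanism_iff r tie n _).1 ((hδ n _).2 le_rfl)
    refine ⟨fun n => δ (n - 1), isTheta_inv_sqrt (C := C) hc (shift ?_) (shift ?_), fun n => ?_⟩
    · filter_upwards [hT] with n hn
      exact hn.trans (hle n _ _ _)
    · exact Eventually.of_forall fun n =>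
        (hδ n _).1 ((isDDP_winnerMechanism_iff r tie n _).2 (hupper n))
    · refine isExact_zero_of_iff ?_ (hδ n)
      have := hle n y y T
      rwa [sub_self] at this
  · choose δ hδ using exists_exact_isSimDDP r tie
    have hle : ∀ n, ∃ q ∈ stdSimplex ℝ (Fin m), ∀ x S,
        |winProb r tie n x S - ∑ c ∈ Finset.univ.filter (· ∈ S), q c| ≤ δ n := fun n =>
      (isSimDDP_winnerMechanism_iff r tie n _).1 ((hδ n _).2 le_rfl)
    refine ⟨fun n => δ (n - 1), isTheta_inv_sqrt (c := c / 2) (C := C) (by positivity)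
      (shift ?_) (shift ?_), fun n => ?_⟩
    · filter_upwards [hT] with n hn
      obtain ⟨q, -, hq⟩ := hle n
      have h1 := (abs_le.1 (hq y T)).2
      have h2 := (abs_le.1 (hq y' T)).1
      rw [div_right_comm]
      show _ ≤ δ n
      linarith
    · refine Eventually.of_forall fun n =>
        (hδ n _).1 ((isSimDDP_winnerMechanism_iff r tie n _).2
          ⟨_, winProb_mem_stdSimplex r tie n y, fun x S => ?_⟩)
      rw [← winProb_eq_sum, abs_le]
      constructor <;> linarith [hupper n x y S, hupper n y x S]
    · refine isExact_zero_of_iff ?_ (hδ n)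
      obtain ⟨q, -, hq⟩ := hle n
      exact (abs_nonneg _).trans (hq y T)

end Parameters

/-! ### The influence of one vote on the law of the winner -/

section Influence

variable {m : ℕ}

open Classical in
/-- The influence of one vote as a correlation of the outcome with the histogram. -/
theorem winProb_sub_winProb (r : Rule m) (tie : Ranking m) (n : ℕ) (x x' : Ranking m)
    (S : Set (Fin m)) :
    winProb r tie n x S - winProb r tie n x' S =
      (∑ D : Fin (n + 1) → Ranking m, ((hist D x : ℝ) - hist D x') *
        if r.winner tie (hist D) ∈ S then (1 : ℝ) else 0) /
      (((n + 1 : ℕ) : ℝ) * (Fintype.card (Ranking m) : ℝ) ^ n) := by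
  simp only [sub_mul, Finset.sum_sub_distrib]
  rw [sum_hist_mul x (fun P => if r.winner tie P ∈ S then (1 : ℝ) else 0),
    sum_hist_mul x' (fun P => if r.winner tie P ∈ S then (1 : ℝ) else 0), ← mul_sub,
    Nat.cast_succ, mul_div_mul_left _ _ (by positivity), sub_div]
  rfl

theorem winProb_sub_le (r : Rule m) (tie : Ranking m) (n : ℕ) (x x' : Ranking m)
    (S : Set (Fin m)) :
    winProb r tie n x S - winProb r tie n x' S ≤
      (Fintype.card (Ranking m) * Real.sqrt 2) / Real.sqrt ((n + 1 : ℕ) : ℝ) := by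
  classical
  have hN : (0 : ℝ) < Fintype.card (Ranking m) := by exact_mod_cast Fintype.card_pos
  have hn : (0 : ℝ) < ((n + 1 : ℕ) : ℝ) := by positivity
  have hs : 0 < Real.sqrt ((n + 1 : ℕ) : ℝ) := Real.sqrt_pos.2 hn
  rw [winProb_sub_winProb, div_le_div_iff₀ (by positivity) hs]
  have h := sum_hist_sub_mul_le (n := n + 1) x x'
    (fun P => if r.winner tie P ∈ S then (1 : ℝ) else 0)
    (fun P => by split_ifs <;> norm_num) (fun P => by split_ifs <;> norm_num)
  refine (mul_le_mul_of_nonneg_right h hs.le).trans (le_of_eq ?_)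
  rw [Real.sqrt_mul (by norm_num), pow_succ, ← mul_assoc, mul_assoc _ (Real.sqrt _) (Real.sqrt _),
    Real.mul_self_sqrt hn.le]
  ring

variable [NeZero m]

/-- The candidate of highest priority wins as soon as it is among the tied winners. -/
theorem winner_eq_iff (r : Rule m) (tie : Ranking m) (P : Profile m) :
    r.winner tie P = tie.symm 0 ↔ tie.symm 0 ∈ r.winners P := by
  constructor
  · intro h
    obtain ⟨c, hc, h1⟩ := Finset.mem_image.1
      (Finset.min'_mem ((r.winners P).image tie) ((r.nonempty P).image tie))
    rw [← h, Rule.winner, ← h1, Equiv.symm_apply_apply]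
    exact hc
  · intro h
    rw [Rule.winner]
    congr 1
    refine le_antisymm (Finset.min'_le _ _ (Finset.mem_image.2 ⟨_, h, ?_⟩)) (Fin.zero_le _)
    simp

open Classical in
/-- Pairing each database with the one in which `x` and `x'` are exchanged makes all contributions
to the correlation nonnegative; those of the tilted databases are of order `√n`. -/
theorem exists_le_winProb_sub (hm : 2 ≤ m) {r : Rule m} {tie : Ranking m}
    (hr : Responsive r (tie.symm 0)) :
    ∃ c : ℝ, 0 < c ∧ ∃ x x' S, ∀ᶠ n : ℕ in atTop, c / Real.sqrt ((n + 1 : ℕ) : ℝ) ≤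
      winProb r tie n x S - winProb r tie n x' S := by
  set a := tie.symm 0 with ha
  obtain ⟨x, x', hl⟩ := exists_liftsToTop a
  obtain ⟨c, hc, hev⟩ := exists_tilted_fraction x x' (hl.ne hm)
  set N : ℝ := ((Fintype.card (Ranking m) : ℕ) : ℝ) with hN
  have hNpos : 0 < N := by rw [hN]; exact_mod_cast Fintype.card_pos
  refine ⟨c * N * (2 * N + 2), by positivity, x, x', {a}, ?_⟩
  filter_upwards [(tendsto_add_atTop_nat 1).eventually hev] with n hn
  set F : Profile m → ℝ := fun P => if a ∈ r.winners P then 1 else 0 with hF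
  set σ := Equiv.swap x x' with hσ
  have hn0 : (0 : ℝ) < ((n + 1 : ℕ) : ℝ) := by positivity
  set s := Real.sqrt ((n + 1 : ℕ) : ℝ) with hs
  have hs0 : 0 < s := Real.sqrt_pos.2 hn0
  have hss : s * s = ((n + 1 : ℕ) : ℝ) := Real.mul_self_sqrt hn0.le
  rw [winProb_sub_winProb]
  simp only [Set.mem_singleton_iff, ha, winner_eq_iff]
  simp only [← ha]
  change _ ≤ (∑ D : Fin (n + 1) → Ranking m, ((hist D x : ℝ) - hist D x') * F (hist D)) / _
  have hswap : ∑ D : Fin (n + 1) → Ranking m, ((hist D x : ℝ) - hist D x') * F (hist D) =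
      ∑ D : Fin (n + 1) → Ranking m, -(((hist D x : ℝ) - hist D x') *
        F (fun V => hist D (σ V))) := by
    rw [← (Equiv.piCongrRight fun _ : Fin (n + 1) => σ).sum_comp]
    refine Finset.sum_congr rfl fun D _ => ?_
    have h1 : hist ((Equiv.piCongrRight fun _ : Fin (n + 1) => σ) D) =
        fun V => hist D (σ V) := hist_comp D σ
    rw [h1]
    simp only [hσ, Equiv.swap_apply_left, Equiv.swap_apply_right]
    ring
  have hmono : ∀ P : Profile m, 0 < numVotes P → P x' ≤ P x → F (fun V => P (σ V)) ≤ F P := by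
    intro P hP hle
    have hraise := hl.raises P hle
    simp only [hF]
    split_ifs with h1 h2
    · exact le_rfl
    · exact absurd (hr.mono _ _ (hraise.numVotes_eq ▸ hP) hraise h1) h2
    · exact zero_le_one
    · exact le_rfl
  have hterm : ∀ D : Fin (n + 1) → Ranking m,
      0 ≤ ((hist D x : ℝ) - hist D x') * (F (hist D) - F (fun V => hist D (σ V))) := by
    intro D
    have hpos : 0 < numVotes (hist D) := by rw [numVotes_hist]; omega
    rcases le_total (hist D x') (hist D x) with h | h
    · exact mul_nonneg (sub_nonneg.2 (by exact_mod_cast h)) (sub_nonneg.2 (hmono _ hpos h))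
    · refine mul_nonneg_of_nonpos_of_nonpos (sub_nonpos.2 (by exact_mod_cast h))
        (sub_nonpos.2 ?_)
      have h2 := hmono (fun V => hist D (σ V)) (by
        rwa [numVotes, Equiv.sum_comp σ (hist D)]) (by simpa [hσ] using h)
      simpa [hσ] using h2
  have htilt : ∀ D : Fin (n + 1) → Ranking m, Tilted x x' D →
      2 * ((2 * N + 2) * s) ≤
        ((hist D x : ℝ) - hist D x') * (F (hist D) - F (fun V => hist D (σ V))) := by
    rintro D ⟨h1, h2, h3⟩
    simp only [← hN, ← hs] at h1 h2 h3
    have hR : N * (2 * s) < (2 * N + 2) * s := by nlinarith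
    have htop := hl.isTop hm (hist D) _ _ _ (by positivity) hR h1 h2 h3
    have hbot := hl.isBottom hm (fun V => hist D (σ V)) _ _ _ (by positivity) hR
      (fun V hV hV' => by rw [hσ, Equiv.swap_apply_of_ne_of_ne hV hV']; exact h1 V hV hV')
      (by rw [hσ, Equiv.swap_apply_left]; exact h3)
      (by rw [hσ, Equiv.swap_apply_right]; exact h2)
    simp only [hF]
    rw [if_pos (hr.win _ htop), if_neg (hr.lose _ hbot)]
    linarith
  have hsum : (2 * ((2 * N + 2) * s)) * (c * N ^ (n + 1)) ≤
      2 * ∑ D : Fin (n + 1) → Ranking m, ((hist D x : ℝ) - hist D x') * F (hist D) := by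
    calc (2 * ((2 * N + 2) * s)) * (c * N ^ (n + 1))
        ≤ (2 * ((2 * N + 2) * s)) *
          (Finset.univ.filter (fun D : Fin (n + 1) → Ranking m => Tilted x x' D)).card := by
          gcongr
      _ = ∑ D : Fin (n + 1) → Ranking m with Tilted x x' D, 2 * ((2 * N + 2) * s) := by
          rw [Finset.sum_const, nsmul_eq_mul, mul_comm]
      _ ≤ ∑ D : Fin (n + 1) → Ranking m with Tilted x x' D,
          ((hist D x : ℝ) - hist D x') * (F (hist D) - F (fun V => hist D (σ V))) :=
          Finset.sum_le_sum fun D hD => htilt D (Finset.mem_filter.1 hD).2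
      _ ≤ ∑ D : Fin (n + 1) → Ranking m,
          ((hist D x : ℝ) - hist D x') * (F (hist D) - F (fun V => hist D (σ V))) :=
          Finset.sum_le_sum_of_subset_of_nonneg (Finset.filter_subset _ _) fun D _ _ => hterm D
      _ = _ := by
          rw [two_mul]
          nth_rewrite 2 [hswap]
          rw [← Finset.sum_add_distrib]
          exact Finset.sum_congr rfl fun D _ => by ring
  rw [div_le_div_iff₀ hs0 (by positivity), ← hss]
  have h5 : (2 * N + 2) * s * (c * N ^ (n + 1)) ≤
      ∑ D : Fin (n + 1) → Ranking m, ((hist D x : ℝ) - hist D x') * F (hist D) := by linarith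
  calc c * N * (2 * N + 2) * (s * s * N ^ n) = ((2 * N + 2) * s * (c * N ^ (n + 1))) * s := by
        ring
    _ ≤ _ := mul_le_mul_of_nonneg_right h5 hs0.le

theorem Responsive.isInvSqrtExactDDP (hm : 2 ≤ m) {r : Rule m} {tie : Ranking m}
    (hr : Responsive r (tie.symm 0)) : IsInvSqrtExactDDP r tie := by
  obtain ⟨c, hc, h⟩ := exists_le_winProb_sub hm hr
  exact isInvSqrtExactDDP_of_bounds hc (winProb_sub_le r tie) h

end Influence

end Voting
end

theorem mainTheorem7 (m : ℕ) [NeZero m] (hm : 2 ≤ m) (tie : Voting.Ranking m) :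
    Voting.IsInvSqrtExactDDP Voting.plurality tie ∧
    Voting.IsInvSqrtExactDDP Voting.veto tie ∧
    (∀ k : ℕ, 1 ≤ k → k < m → Voting.IsInvSqrtExactDDP (Voting.kApproval k) tie) ∧
    Voting.IsInvSqrtExactDDP Voting.borda tie ∧
    Voting.IsInvSqrtExactDDP Voting.maximin tie ∧
    (∀ α : ℝ, 0 ≤ α → α ≤ 1 → Voting.IsInvSqrtExactDDP (Voting.copeland α) tie) ∧
    Voting.IsInvSqrtExactDDP Voting.bucklin tie ∧
    (∀ τ : Fin m × Fin m ≃ Fin (m * m),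
      Voting.IsInvSqrtExactDDP (Voting.rankedPairs τ) tie) ∧
    Voting.IsInvSqrtExactDDP Voting.schulze tie :=
  ⟨(Voting.responsive_plurality hm _).isInvSqrtExactDDP hm,
    (Voting.responsive_veto hm _).isInvSqrtExactDDP hm,
    fun _ hk hkm => (Voting.responsive_kApproval hk hkm _).isInvSqrtExactDDP hm,
    (Voting.responsive_borda hm _).isInvSqrtExactDDP hm,
    (Voting.responsive_maximin hm _).isInvSqrtExactDDP hm,
    fun _ h0 h1 => (Voting.responsive_copeland hm h0 h1 _).isInvSqrtExactDDP hm,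
    (Voting.responsive_bucklin hm _).isInvSqrtExactDDP hm,
    fun τ => (Voting.responsive_rankedPairs hm τ _).isInvSqrtExactDDP hm,
    (Voting.responsive_schulze hm _).isInvSqrtExactDDP hm⟩
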